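/- All graphs are finite, simple and undirected, with $n\ge 3$ vertices. For a graph $G=(V,E)$, a vertex $v$ and a set $X\subseteq V$, let $d_X(v)$ be the number of neighbours of $v$ in $X$, and let $\overline{S}=V\setminus S$. A set $S\subset V$ with $2\le |S|<|V|$ is a *proportionally dense subgraph* (PDS) of $G$ if $$\frac{d_S(v)}{|S|-1}\ \ge\ \frac{d_{\overline{S}}(v)}{|\overline{S}|}\qquad\text{for every } v\in S ,$$ and a *connected PDS* if moreover $G[S]$ is connected. The *h-index* $h(G)$ is the largest integer $h$ such that at least $h$ vertices of $G$ have degree at least $h$. The problem MaxPDS asks, given $G$, for a PDS of $G$ of maximum size; connected MaxPDS asks for a connected PDS of $G$ of maximum size, or the answer that $G$ has no connected PDS. **Theorem.** On graphs $G$ with $h(G)\le 2$, MaxPDS can be solved in time $\mathcal{O}(n^5)$, and connected MaxPDS can be solved in time $\mathcal{O}(n^5)$. Here the input is the adjacency matrix of $G$, and time is the number of steps of a word RAM with words of $\mathcal{O}(\log n)$ bits and unit-cost arithmetic, comparisons and memory accesses. -/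

import Mathlib

/-! ### Graph notions -/

section Graph

variable {V : Type*} [Fintype V]

open Classical in
/-- `degIn G S v` is the number `d_S(v)` of neighbours of `v` in the set `S`. -/
noncomputable def degIn (G : SimpleGraph V) (S : Finset V) (v : V) : ℕ :=
  (S.filter (fun w => G.Adj v w)).card

open Classical in
/-- `S` is (the vertex set of) a proportionally dense subgraph of `G`: it has at least two vertices,
is a proper subset of the vertex set, and every `v ∈ S` satisfies
`d_S(v) / (|S| - 1) ≥ d_{V ∖ S}(v) / |V ∖ S|`. Both denominators are positive. -/
def IsPDS (G : SimpleGraph V) (S : Finset V) : Prop :=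
  2 ≤ S.card ∧ S.card < Fintype.card V ∧
    ∀ v ∈ S, (degIn G S v : ℚ) / ((S.card : ℚ) - 1) ≥ (degIn G Sᶜ v : ℚ) / (Sᶜ.card : ℚ)

/-- A connected PDS is a PDS whose vertices induce a connected subgraph. -/
def IsConnectedPDS (G : SimpleGraph V) (S : Finset V) : Prop :=
  IsPDS G S ∧ (G.induce (S : Set V)).Connected

/-- `S` satisfies `p` and has maximum cardinality among all vertex sets satisfying `p`. -/
def IsMaximumFor (p : Finset V → Prop) (S : Finset V) : Prop :=
  p S ∧ ∀ S', p S' → S'.card ≤ S.card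

open Classical in
/-- The h-index of `G`: the largest `h` such that at least `h` vertices have degree at least `h`. -/
noncomputable def hIndex (G : SimpleGraph V) : ℕ :=
  sSup {h : ℕ | h ≤ (Finset.univ.filter (fun v : V => h ≤ degIn G Finset.univ v)).card}

/-- The supremum in the definition of the h-index is an attained maximum. -/
theorem isGreatest_hIndex (G : SimpleGraph V) :
    IsGreatest {h : ℕ | h ≤ Set.ncard {v : V | h ≤ Set.ncard (G.neighborSet v)}} (hIndex G) := by
  classical
  have hs : {h : ℕ | h ≤ Set.ncard {v : V | h ≤ Set.ncard (G.neighborSet v)}} =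
      {h : ℕ | h ≤ (Finset.univ.filter (fun v : V => h ≤ degIn G Finset.univ v)).card} := by
    ext h
    have hd : ∀ v : V, Set.ncard (G.neighborSet v) = degIn G Finset.univ v := by
      intro v
      rw [degIn, ← Set.ncard_coe_finset]
      congr 1
      ext w
      simp
    have hc : {v : V | h ≤ Set.ncard (G.neighborSet v)} =
        ((Finset.univ.filter (fun v : V => h ≤ degIn G Finset.univ v) : Finset V) : Set V) := by
      ext v
      simp [hd]
    change h ≤ _ ↔ h ≤ _
    rw [hc, Set.ncard_coe_finset]
  have hb : BddAbove {h : ℕ | h ≤ (Finset.univ.filter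
      (fun v : V => h ≤ degIn G Finset.univ v)).card} :=
    ⟨Fintype.card V, fun h hh => le_trans hh (Finset.card_le_univ _)⟩
  rw [hs]
  exact ⟨Nat.sSup_mem ⟨0, Nat.zero_le _⟩ hb, fun h hh => le_csSup hb hh⟩

end Graph

/-! ### Structured programs for the word RAM

A memory consists of scalar registers and of arrays; registers, arrays and array cells are numbered
by natural numbers, and a program mentions finitely many registers and arrays. Cells hold natural
numbers below a word bound `W`. Arithmetic, comparisons and array accesses have unit cost. -/

namespace WordRAM

/-- The contents of the registers and of the arrays (array number, then index). -/
structure Memory where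
  reg : ℕ → ℕ
  arr : ℕ → ℕ → ℕ

/-- The binary operations. -/
inductive BinOp where
  | add | sub | mul | div | mod | eq | lt

/-- Subtraction is truncated, `div` and `mod` are natural-number division and remainder;
comparisons return `1` for true and `0` for false. -/
def BinOp.apply : BinOp → ℕ → ℕ → ℕ
  | .add, x, y => x + y
  | .sub, x, y => x - y
  | .mul, x, y => x * y
  | .div, x, y => x / y
  | .mod, x, y => x % y
  | .eq, x, y => if x = y then 1 else 0
  | .lt, x, y => if x < y then 1 else 0

/-- Expressions: constants, registers, array cells `a[e]`, and operations. -/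
inductive Exp where
  | const (k : ℕ)
  | reg (x : ℕ)
  | arr (a : ℕ) (e : Exp)
  | op (o : BinOp) (e₁ e₂ : Exp)

/-- The value of an expression. -/
def Exp.eval (m : Memory) : Exp → ℕ
  | .const k => k
  | .reg x => m.reg x
  | .arr a e => m.arr a (e.eval m)
  | .op o e₁ e₂ => o.apply (e₁.eval m) (e₂.eval m)

/-- The number of unit-cost steps that evaluating an expression takes. -/
def Exp.cost : Exp → ℕ
  | .const _ => 1
  | .reg _ => 1
  | .arr _ e => e.cost + 1
  | .op _ e₁ e₂ => e₁.cost + e₂.cost + 1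

/-- Programs: do nothing; write a register; write an array cell; sequential composition;
conditional; loop while the value of `e` is nonzero. -/
inductive Prog where
  | nop
  | set (x : ℕ) (e : Exp)
  | store (a : ℕ) (i e : Exp)
  | seq (p q : Prog)
  | cond (e : Exp) (p q : Prog)
  | loop (e : Exp) (p : Prog)

/-- Overwrite register `x` by `v`. -/
def Memory.setReg (m : Memory) (x v : ℕ) : Memory :=
  { m with reg := Function.update m.reg x v }

/-- Overwrite cell `i` of array `a` by `v`. -/
def Memory.setArr (m : Memory) (a i v : ℕ) : Memory :=
  { m with arr := Function.update m.arr a (Function.update (m.arr a) i v) }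

/-- `Exec W p m t m'`: with word bound `W`, the program `p` started in memory `m` halts after exactly
`t` steps in memory `m'`. Writing a value that is not below `W` is impossible: such a run is stuck
and does not halt. Since the finitely many expressions of a program are fixed, the values that occur
inside them, addresses included, are then polynomially bounded in `W` as well. -/
inductive Exec (W : ℕ) : Prog → Memory → ℕ → Memory → Prop where
  | nop (m : Memory) : Exec W .nop m 1 m
  | set (x : ℕ) (e : Exp) (m : Memory) (h : e.eval m < W) :
      Exec W (.set x e) m (e.cost + 1) (m.setReg x (e.eval m))
  | store (a : ℕ) (i e : Exp) (m : Memory) (h : e.eval m < W) :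
      Exec W (.store a i e) m (i.cost + e.cost + 1) (m.setArr a (i.eval m) (e.eval m))
  | seq {p q : Prog} {m m' m'' : Memory} {t t' : ℕ}
      (hp : Exec W p m t m') (hq : Exec W q m' t' m'') : Exec W (.seq p q) m (t + t') m''
  | condTrue {e : Exp} {p q : Prog} {m m' : Memory} {t : ℕ} (h : e.eval m ≠ 0)
      (hp : Exec W p m t m') : Exec W (.cond e p q) m (e.cost + 1 + t) m'
  | condFalse {e : Exp} {p q : Prog} {m m' : Memory} {t : ℕ} (h : e.eval m = 0)
      (hq : Exec W q m t m') : Exec W (.cond e p q) m (e.cost + 1 + t) m'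
  | loopTrue {e : Exp} {p : Prog} {m m' m'' : Memory} {t t' : ℕ} (h : e.eval m ≠ 0)
      (hp : Exec W p m t m') (hl : Exec W (.loop e p) m' t' m'') :
      Exec W (.loop e p) m (e.cost + 1 + t + t') m''
  | loopFalse {e : Exp} {p : Prog} {m : Memory} (h : e.eval m = 0) :
      Exec W (.loop e p) m (e.cost + 1) m

/-- Programs are deterministic: the step count and the final memory are unique. -/
theorem Exec.deterministic {W : ℕ} {p : Prog} {m m₁ : Memory} {t₁ : ℕ}
    (h₁ : Exec W p m t₁ m₁) :
    ∀ {t₂ : ℕ} {m₂ : Memory}, Exec W p m t₂ m₂ → t₁ = t₂ ∧ m₁ = m₂ := by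
  induction h₁ with
  | nop m => intro t₂ m₂ h₂; cases h₂; exact ⟨rfl, rfl⟩
  | set x e m h => intro t₂ m₂ h₂; cases h₂; exact ⟨rfl, rfl⟩
  | store a i e m h => intro t₂ m₂ h₂; cases h₂; exact ⟨rfl, rfl⟩
  | seq hp hq ihp ihq =>
    intro t₂ m₂ h₂
    cases h₂ with
    | seq hp' hq' =>
      obtain ⟨rfl, rfl⟩ := ihp hp'
      obtain ⟨rfl, rfl⟩ := ihq hq'
      exact ⟨rfl, rfl⟩
  | condTrue h hp ih =>
    intro t₂ m₂ h₂
    cases h₂ with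
    | condTrue h' hp' => obtain ⟨rfl, rfl⟩ := ih hp'; exact ⟨rfl, rfl⟩
    | condFalse h' hq' => exact absurd h' h
  | condFalse h hq ih =>
    intro t₂ m₂ h₂
    cases h₂ with
    | condTrue h' hp' => exact absurd h h'
    | condFalse h' hq' => obtain ⟨rfl, rfl⟩ := ih hq'; exact ⟨rfl, rfl⟩
  | loopTrue h hp hl ihp ihl =>
    intro t₂ m₂ h₂
    cases h₂ with
    | loopTrue h' hp' hl' =>
      obtain ⟨rfl, rfl⟩ := ihp hp'
      obtain ⟨rfl, rfl⟩ := ihl hl'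
      exact ⟨rfl, rfl⟩
    | loopFalse h' => exact absurd h' h
  | loopFalse h =>
    intro t₂ m₂ h₂
    cases h₂ with
    | loopTrue h' hp' hl' => exact absurd h h'
    | loopFalse h' => exact ⟨rfl, rfl⟩

open Classical in
/-- The input memory for a graph on the vertices `0, …, n - 1`: register `0` holds `n`, array `0`
holds the adjacency matrix row by row, and everything else is `0`. -/
noncomputable def inputMemory {n : ℕ} (G : SimpleGraph (Fin n)) : Memory where
  reg := fun x => if x = 0 then n else 0
  arr := fun a i =>
    if a = 0 ∧ ∃ u v : Fin n, i = (u : ℕ) * n + (v : ℕ) ∧ G.Adj u v then 1 else 0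

/-- The output read off a final memory: if register `1` holds `0`, the answer is "no solution";
otherwise it is the vertex set whose indicator vector is stored in array `1`. -/
def output (n : ℕ) (m : Memory) : Option (Finset (Fin n)) :=
  if m.reg 1 = 0 then none else some (Finset.univ.filter (fun v : Fin n => m.arr 1 v ≠ 0))

end WordRAM

/-! ### The problems -/

/-- A problem whose instances are graphs and whose answers are vertex sets or "no solution":
the relation between an instance and its correct answers. -/
abbrev GraphProblem : Type :=
  ∀ n : ℕ, SimpleGraph (Fin n) → Option (Finset (Fin n)) → Prop

/-- MaxPDS: the answer has to be a PDS of maximum size. -/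
def MaxPDS : GraphProblem := fun _ G o =>
  ∃ S, o = some S ∧ IsMaximumFor (IsPDS G) S

/-- Connected MaxPDS: the answer has to be a connected PDS of maximum size, or "no solution" if the
graph has no connected PDS (an edgeless graph, for instance). -/
def ConnectedMaxPDS : GraphProblem := fun _ G o =>
  (∃ S, o = some S ∧ IsMaximumFor (IsConnectedPDS G) S) ∨
    (o = none ∧ ∀ S, ¬ IsConnectedPDS G S)

/-- The problem `Q`, restricted to the class `K` of graphs, is solvable in time `O(T(n))`, where `n`
is the number of vertices: one fixed program, with words of `O(log n)` bits (word bound `n ^ k`),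
halts on every graph of the class after at most `C * T n` steps with a correct answer. -/
def SolvableInTime (Q : GraphProblem) (K : ∀ n : ℕ, SimpleGraph (Fin n) → Prop) (T : ℕ → ℕ) :
    Prop :=
  ∃ (p : WordRAM.Prog) (C k : ℕ), ∀ (n : ℕ) (G : SimpleGraph (Fin n)), K n G →
    ∃ (t : ℕ) (m : WordRAM.Memory),
      WordRAM.Exec (n ^ k) p (WordRAM.inputMemory G) t m ∧ t ≤ C * T n ∧
        Q n G (WordRAM.output n m)

set_option linter.unusedSectionVars false

/-! ### Evaluation, cost and frame rules for programs built from counting loops. -/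

namespace WordRAM

/-! Let `a`, `b` be two vertices of largest degree. Since h(G) ≤ 2, every other vertex has degree at
most 2 (`degIn_le_two_of_hIndex`). Substituting d(v) - d_S(v) for the outer degree turns the PDS
inequality into d(v)(|S|-1) ≤ d_S(v)(n-1) (`isPDS_iff`): the fraction of neighbours of v inside S
must be at least (|S|-1)/(n-1).

If |S| exceeds ⌈n/2⌉, that threshold is above 1/2, so a vertex of degree at most 2 needs all its
neighbours inside (`nbrClosed_of_large`). Such an S is a union of components of G - {a, b} (the
pieces), possibly with `a` or `b` added, and only `a` and `b` still have to be checked. That check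
needs only |S|, the numbers of selected neighbours of `a` and of `b`, and whether `a` and `b` are
adjacent. For connectedness it is enough that every selected piece touches a selected one of `a`,
`b`, and that `a` and `b`, if both are selected, are adjacent or joined through a piece. If neither
is selected, there must be exactly one piece (`connSet_iff_pieces`). All of this is additive over
pieces, and three base-`n` digits together with a leading bonus count pack it into one number below
n^4. The best closed target is therefore found by a subset-sum table with n items and n^4 totals,
once for each of the four choices of membership of `a` and `b` (`target_of_good`, `exists_good`,
`runs_select`). This table gives the n^5.

It remains to deal with targets of size at most ⌈n/2⌉. Grow a connected set from `a` avoiding `b`,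
starting with neighbours of `a`, and symmetrically from `b`. If one of them reaches size ⌈n/2⌉ it is
a connected PDS (`ConnSet.isPDS_half`), so it beats all small targets. If both get stuck earlier,
their union has fewer than n vertices and no outgoing edge, so G is disconnected
(`exists_isolated_of_small`). Then closed targets suffice again: without connectivity, the union or
its complement is a closed PDS of size at least ⌈n/2⌉; with connectivity, every connected PDS lies
in a proper component, which is itself a closed connected PDS (`card_le_of_nbrClosed`).

On the machine side, `Runs` combines halting, a time bound computed from the program text and a
postcondition; each stage is verified by loop invariants, and `Exec.frame` says what it leaves
untouched. -/

instance (k : ℕ) : OfNat Exp k := ⟨.const k⟩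
instance : Add Exp := ⟨.op .add⟩
instance : Sub Exp := ⟨.op .sub⟩
instance : Mul Exp := ⟨.op .mul⟩
instance : Div Exp := ⟨.op .div⟩
instance : Mod Exp := ⟨.op .mod⟩

/-- The comparison `e < f` as an expression with value `0` or `1`. -/
def Exp.ltb (e f : Exp) : Exp := .op .lt e f

/-- The comparison `e = f` as an expression with value `0` or `1`. -/
def Exp.eqb (e f : Exp) : Exp := .op .eq e f

section Eval

variable (m : Memory) (e f : Exp)

@[simp] theorem Exp.eval_zero : (0 : Exp).eval m = 0 := rfl
@[simp] theorem Exp.eval_one : (1 : Exp).eval m = 1 := rfl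
@[simp] theorem Exp.eval_two : (2 : Exp).eval m = 2 := rfl
@[simp] theorem Exp.eval_const (k : ℕ) : (Exp.const k).eval m = k := rfl
@[simp] theorem Exp.eval_reg (x : ℕ) : (Exp.reg x).eval m = m.reg x := rfl
@[simp] theorem Exp.eval_arr (a : ℕ) : (Exp.arr a e).eval m = m.arr a (e.eval m) := rfl
@[simp] theorem Exp.eval_add : (e + f).eval m = e.eval m + f.eval m := rfl
@[simp] theorem Exp.eval_sub : (e - f).eval m = e.eval m - f.eval m := rfl
@[simp] theorem Exp.eval_mul : (e * f).eval m = e.eval m * f.eval m := rfl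
@[simp] theorem Exp.eval_div : (e / f).eval m = e.eval m / f.eval m := rfl
@[simp] theorem Exp.eval_mod : (e % f).eval m = e.eval m % f.eval m := rfl
@[simp] theorem Exp.eval_ltb :
    (e.ltb f).eval m = if e.eval m < f.eval m then 1 else 0 := rfl
@[simp] theorem Exp.eval_eqb :
    (e.eqb f).eval m = if e.eval m = f.eval m then 1 else 0 := rfl

@[simp] theorem Exp.cost_zero : (0 : Exp).cost = 1 := rfl
@[simp] theorem Exp.cost_one : (1 : Exp).cost = 1 := rfl
@[simp] theorem Exp.cost_two : (2 : Exp).cost = 1 := rfl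
@[simp] theorem Exp.cost_const (k : ℕ) : (Exp.const k).cost = 1 := rfl
@[simp] theorem Exp.cost_reg (x : ℕ) : (Exp.reg x).cost = 1 := rfl
@[simp] theorem Exp.cost_arr (a : ℕ) : (Exp.arr a e).cost = e.cost + 1 := rfl
@[simp] theorem Exp.cost_add : (e + f).cost = e.cost + f.cost + 1 := rfl
@[simp] theorem Exp.cost_sub : (e - f).cost = e.cost + f.cost + 1 := rfl
@[simp] theorem Exp.cost_mul : (e * f).cost = e.cost + f.cost + 1 := rfl
@[simp] theorem Exp.cost_div : (e / f).cost = e.cost + f.cost + 1 := rfl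
@[simp] theorem Exp.cost_mod : (e % f).cost = e.cost + f.cost + 1 := rfl
@[simp] theorem Exp.cost_ltb : (e.ltb f).cost = e.cost + f.cost + 1 := rfl
@[simp] theorem Exp.cost_eqb : (e.eqb f).cost = e.cost + f.cost + 1 := rfl

@[simp] theorem Memory.setReg_reg (x v y : ℕ) :
    (m.setReg x v).reg y = if y = x then v else m.reg y := by
  simp [Memory.setReg, Function.update_apply]
@[simp] theorem Memory.setReg_arr (x v : ℕ) : (m.setReg x v).arr = m.arr := rfl
@[simp] theorem Memory.setArr_reg (a i v : ℕ) : (m.setArr a i v).reg = m.reg := rfl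
theorem Memory.setArr_arr (a i v b : ℕ) :
    (m.setArr a i v).arr b = if b = a then Function.update (m.arr a) i v else m.arr b := by
  simp [Memory.setArr, Function.update_apply]
@[simp] theorem Memory.setArr_arr_apply (a i v b j : ℕ) :
    (m.setArr a i v).arr b j = if b = a ∧ j = i then v else m.arr b j := by
  by_cases h : b = a
  · subst h; simp [Memory.setArr, Function.update_apply]
  · simp [Memory.setArr, h]

end Eval

/-- Run `p` with register `x` taking the values `0, …, N - 1`, where `N` is a register. -/
def forLoop (x N : ℕ) (p : Prog) : Prog :=
  .seq (.set x 0) (.loop (.op .lt (.reg x) (.reg N)) (.seq p (.set x (.reg x + 1))))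

/-- A bound for the running time of a program whose loops are all counting loops, in terms of
the values `ρ` of the registers that bound the loops. -/
def Prog.time (ρ : ℕ → ℕ) : Prog → ℕ
  | .nop => 1
  | .set _ e => e.cost + 1
  | .store _ i e => i.cost + e.cost + 1
  | .seq p q => p.time ρ + q.time ρ
  -- The sum of the branches instead of their maximum keeps the bound polynomial in the loop bounds.
  | .cond e p q => e.cost + 1 + (p.time ρ + q.time ρ)
  | .loop (.op .lt (.reg _) (.reg N)) p => ρ N * (p.time ρ + 4) + 4
  -- Junk value. It cannot produce a false bound, because `Runs` asserts `t ≤ p.time ρ` for an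
  -- actual run; all loops used here are counting loops.
  | .loop _ _ => 0

/-- The registers a program may write. -/
def Prog.regs : Prog → List ℕ
  | .nop => []
  | .set x _ => [x]
  | .store _ _ _ => []
  | .seq p q => p.regs ++ q.regs
  | .cond _ p q => p.regs ++ q.regs
  | .loop _ p => p.regs

/-- The arrays a program may write. -/
def Prog.arrs : Prog → List ℕ
  | .nop => []
  | .set _ _ => []
  | .store a _ _ => [a]
  | .seq p q => p.arrs ++ q.arrs
  | .cond _ p q => p.arrs ++ q.arrs
  | .loop _ p => p.arrs

/-- The 8 is one guard test and one increment, at 4 each; the 6 is the initial assignment (2) and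
the final failing test (4). -/
theorem time_forLoop (ρ : ℕ → ℕ) (x N : ℕ) (p : Prog) :
    (forLoop x N p).time ρ = ρ N * (p.time ρ + 8) + 6 := by
  simp only [forLoop, Prog.time, Exp.cost_zero, Exp.cost_one, Exp.cost_add, Exp.cost_reg]
  ring

/-- The memories `m` and `m'` agree on all registers outside `R` and all arrays outside `A`. -/
structure Frame (R A : List ℕ) (m m' : Memory) : Prop where
  reg : ∀ x, x ∉ R → m'.reg x = m.reg x
  arr : ∀ a, a ∉ A → m'.arr a = m.arr a

theorem Frame.refl (R A : List ℕ) (m : Memory) : Frame R A m m := ⟨fun _ _ => rfl, fun _ _ => rfl⟩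

theorem Frame.trans {R A : List ℕ} {m m' m'' : Memory} (h : Frame R A m m')
    (h' : Frame R A m' m'') : Frame R A m m'' :=
  ⟨fun x hx => (h'.reg x hx).trans (h.reg x hx), fun a ha => (h'.arr a ha).trans (h.arr a ha)⟩

theorem Frame.mono {R A R' A' : List ℕ} {m m' : Memory} (h : Frame R A m m')
    (hR : R ⊆ R') (hA : A ⊆ A') : Frame R' A' m m' :=
  ⟨fun x hx => h.reg x fun hx' => hx (hR hx'), fun a ha => h.arr a fun ha' => ha (hA ha')⟩

/-- What a run can change is read off the program text, so later preservation claims reduce to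
membership in explicit lists. -/
theorem Exec.frame {W : ℕ} {p : Prog} {m m' : Memory} {t : ℕ} (h : Exec W p m t m') :
    Frame p.regs p.arrs m m' := by
  induction h with
  | nop m => exact .refl _ _ _
  | set x e m h =>
    exact ⟨fun y hy => by simp_all [Prog.regs], fun _ _ => rfl⟩
  | store a i e m h =>
    exact ⟨fun _ _ => rfl, fun b hb => by simp_all [Prog.arrs, Memory.setArr_arr]⟩
  | seq hp hq ihp ihq =>
    exact (ihp.mono (by simp [Prog.regs]) (by simp [Prog.arrs])).trans
      (ihq.mono (by simp [Prog.regs]) (by simp [Prog.arrs]))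
  | condTrue h hp ih => exact ih.mono (by simp [Prog.regs]) (by simp [Prog.arrs])
  | condFalse h hq ih => exact ih.mono (by simp [Prog.regs]) (by simp [Prog.arrs])
  | loopTrue h hp hl ihp ihl => exact Frame.trans (ihp.mono (by simp [Prog.regs]) (by simp [Prog.arrs])) ihl
  | loopFalse h => exact .refl _ _ _

/-- The program `p`, started in `m`, halts within its time bound in a memory satisfying `Q`. -/
def Runs (W : ℕ) (ρ : ℕ → ℕ) (p : Prog) (m : Memory) (Q : Memory → Prop) : Prop :=
  ∃ t m', Exec W p m t m' ∧ t ≤ p.time ρ ∧ Q m'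

section Rules

variable {W : ℕ} {ρ : ℕ → ℕ} {p q : Prog} {m : Memory} {Q Q' : Memory → Prop}

theorem Runs.mono (h : Runs W ρ p m Q)
    (hQ : ∀ m', Frame p.regs p.arrs m m' → Q m' → Q' m') : Runs W ρ p m Q' := by
  obtain ⟨t, m', he, ht, hq⟩ := h
  exact ⟨t, m', he, ht, hQ m' he.frame hq⟩

theorem Runs.nop (h : Q m) : Runs W ρ .nop m Q := ⟨1, m, .nop m, le_rfl, h⟩

theorem Runs.set {x : ℕ} {e : Exp} (hW : e.eval m < W) (h : Q (m.setReg x (e.eval m))) :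
    Runs W ρ (.set x e) m Q := ⟨_, _, .set x e m hW, le_rfl, h⟩

theorem Runs.store {a : ℕ} {i e : Exp} (hW : e.eval m < W)
    (h : Q (m.setArr a (i.eval m) (e.eval m))) :
    Runs W ρ (.store a i e) m Q := ⟨_, _, .store a i e m hW, le_rfl, h⟩

theorem Runs.seq (h : Runs W ρ p m Q)
    (h' : ∀ m', Frame p.regs p.arrs m m' → Q m' → Runs W ρ q m' Q') :
    Runs W ρ (.seq p q) m Q' := by
  obtain ⟨t, m', he, ht, hq⟩ := h
  obtain ⟨t', m'', he', ht', hq'⟩ := h' m' he.frame hq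
  exact ⟨_, _, .seq he he', Nat.add_le_add ht ht', hq'⟩

theorem Runs.setSeq {x : ℕ} {e : Exp} (hW : e.eval m < W)
    (h : Runs W ρ q (m.setReg x (e.eval m)) Q) : Runs W ρ (.seq (.set x e) q) m Q :=
  Runs.seq (Q := fun m' => m' = m.setReg x (e.eval m)) (.set hW rfl) (by rintro _ - rfl; exact h)

theorem Runs.storeSeq {a : ℕ} {i e : Exp} (hW : e.eval m < W)
    (h : Runs W ρ q (m.setArr a (i.eval m) (e.eval m)) Q) :
    Runs W ρ (.seq (.store a i e) q) m Q :=
  Runs.seq (Q := fun m' => m' = m.setArr a (i.eval m) (e.eval m)) (.store hW rfl)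
    (by rintro _ - rfl; exact h)

theorem Runs.cond {e : Exp} (h : e.eval m ≠ 0 → Runs W ρ p m Q)
    (h' : e.eval m = 0 → Runs W ρ q m Q) : Runs W ρ (.cond e p q) m Q := by
  by_cases he : e.eval m = 0
  · obtain ⟨t, m', hx, ht, hq⟩ := h' he
    exact ⟨_, _, .condFalse he hx, by simp only [Prog.time]; omega, hq⟩
  · obtain ⟨t, m', hx, ht, hq⟩ := h he
    exact ⟨_, _, .condTrue he hx, by simp only [Prog.time]; omega, hq⟩

/-- The body may write neither the counter nor the bound, so the number of rounds is fixed in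
advance. The invariant is required after the increment, and the body may use the frame relative to
the memory before the loop, so invariants need not mention data that no round changes. -/
theorem Runs.forLoop {x N : ℕ} (I : ℕ → Memory → Prop) (hN : m.reg N = ρ N) (hW : ρ N < W)
    (hx : x ∉ p.regs) (hNp : N ∉ p.regs) (hxN : N ≠ x) (h0 : I 0 (m.setReg x 0))
    (hs : ∀ i < ρ N, ∀ m', m'.reg x = i → Frame (x :: p.regs) p.arrs m m' → I i m' →
      Runs W ρ p m' fun m'' => I (i + 1) (m''.setReg x (i + 1)))
    (hQ : ∀ m', Frame (x :: p.regs) p.arrs m m' → I (ρ N) m' → Q m') :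
    Runs W ρ (forLoop x N p) m Q := by
  -- Induction on the number `k` of rounds still to come, with `i` the current counter value.
  have key : ∀ k i, i + k = ρ N → ∀ m', m'.reg x = i → Frame (x :: p.regs) p.arrs m m' → I i m' →
      ∃ t m'', Exec W (.loop (.op .lt (.reg x) (.reg N)) (.seq p (.set x (.reg x + 1)))) m' t m'' ∧
        t ≤ k * (p.time ρ + 8) + 4 ∧ Q m'' := by
    intro k
    induction k with
    | zero =>
      intro i hi m' hm hF hI
      obtain rfl : i = ρ N := by omega
      refine ⟨_, m', .loopFalse ?_, ?_, hQ m' hF hI⟩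
      · have := hF.reg N (by simp [hxN, hNp])
        simp [Exp.eval, BinOp.apply, hm, this, hN]
      · simp [Exp.cost]
    | succ k ih =>
      intro i hi m' hm hF hI
      obtain ⟨t, m₁, he, ht, hq⟩ := hs i (by omega) m' hm hF hI
      have hx₁ : m₁.reg x = i := (he.frame.reg x hx).trans hm
      have hF₁ : Frame (x :: p.regs) p.arrs m (m₁.setReg x (i + 1)) := by
        refine hF.trans (Frame.trans (he.frame.mono (by simp) (by simp)) ?_)
        exact ⟨fun y hy => by simp_all, fun _ _ => rfl⟩
      obtain ⟨t', m₂, he', ht', hq'⟩ := ih (i + 1) (by omega) (m₁.setReg x (i + 1)) (by simp) hF₁ hq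
      refine ⟨_, m₂, .loopTrue (m' := m₁.setReg x (i + 1)) ?_ (.seq he (t' := 4) ?_) he', ?_, hq'⟩
      · have := hF.reg N (by simp [hxN, hNp])
        simp only [Exp.eval, BinOp.apply, hm, this, hN]
        rw [if_pos (by omega)]; exact one_ne_zero
      · have := Exec.set (W := W) x (.reg x + 1) m₁ (by simp; omega)
        simpa [hx₁] using this
      · simp only [Exp.cost]; nlinarith
  obtain ⟨t, m', he, ht, hq⟩ := key (ρ N) 0 (by omega) (m.setReg x 0) (by simp)
    ⟨fun y hy => by simp_all, fun _ _ => rfl⟩ h0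
  refine ⟨_, m', .seq (.set x 0 m (by simp; omega)) he, ?_, hq⟩
  rw [time_forLoop]
  simp only [Exp.cost_zero]; omega

end Rules
end WordRAM

/-! ### Proportionally dense subgraphs -/

section PDS

open Finset
open scoped Classical

variable {V : Type*} [Fintype V] (G : SimpleGraph V)

theorem degIn_mono {S T : Finset V} (h : S ⊆ T) (v : V) : degIn G S v ≤ degIn G T v :=
  card_le_card (filter_subset_filter _ h)

theorem degIn_add_compl (S : Finset V) (v : V) :
    degIn G S v + degIn G Sᶜ v = degIn G univ v := by
  unfold degIn
  rw [← card_union_of_disjoint, ← filter_union, union_compl]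
  exact disjoint_filter_filter disjoint_compl_right

theorem degIn_eq_univ {S : Finset V} {v : V} (h : ∀ u, G.Adj v u → u ∈ S) :
    degIn G S v = degIn G univ v := by
  unfold degIn
  congr 1; ext u; simpa using h u

theorem mem_of_degIn_eq_univ {S : Finset V} {v : V} (h : degIn G S v = degIn G univ v) {u : V}
    (hu : G.Adj v u) : u ∈ S := by
  have : S.filter (fun w => G.Adj v w) = univ.filter (fun w => G.Adj v w) :=
    eq_of_subset_of_card_le (filter_subset_filter _ (subset_univ _)) h.ge
  have h2 : u ∈ S.filter (fun w => G.Adj v w) := by simp [this, hu]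
  exact (mem_filter.1 h2).1

theorem degIn_pos {S : Finset V} {v : V} : 0 < degIn G S v ↔ ∃ u ∈ S, G.Adj v u := by
  simp [degIn, card_pos, Finset.Nonempty]

theorem degIn_eq_zero {S : Finset V} {v : V} : degIn G S v = 0 ↔ ∀ u ∈ S, ¬ G.Adj v u := by
  simp [degIn, filter_eq_empty_iff]

theorem degIn_le_card (S : Finset V) (v : V) : degIn G S v ≤ S.card := card_filter_le _ _

/-- Replacing the outer degree by d - d_S and cross-multiplying, the terms in d_S (|S|-1) cancel.
The result is free of division, and only d_S depends on which vertices S contains. -/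
theorem isPDS_iff (S : Finset V) : IsPDS G S ↔ 2 ≤ S.card ∧ S.card < Fintype.card V ∧
    ∀ v ∈ S, degIn G univ v * (S.card - 1) ≤ degIn G S v * (Fintype.card V - 1) := by
  unfold IsPDS
  refine and_congr_right fun h2 => and_congr_right fun hN => forall₂_congr fun v hv => ?_
  rw [← degIn_add_compl G S v, card_compl]
  have h3 : (0 : ℚ) < (S.card : ℚ) - 1 := by
    have : (2 : ℚ) ≤ S.card := by exact_mod_cast h2
    linarith
  have h4 : (0 : ℚ) < ((Fintype.card V - S.card : ℕ) : ℚ) := by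
    exact_mod_cast Nat.sub_pos_of_lt hN
  rw [ge_iff_le, div_le_div_iff₀ h4 h3]
  obtain ⟨s, hs⟩ : ∃ s, S.card = s + 1 := ⟨S.card - 1, by omega⟩
  obtain ⟨k, hk⟩ : ∃ k, Fintype.card V = s + 1 + k := ⟨Fintype.card V - (s + 1), by omega⟩
  rw [hs, hk]
  simp only [Nat.add_sub_cancel_left, Nat.add_sub_cancel]
  rw [show s + 1 + k - 1 = s + k by omega]
  push_cast
  rw [show (s : ℚ) + 1 - 1 = s by ring]
  norm_cast
  constructor <;> intro h <;> nlinarith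

/-- No edge leaves `S`. -/
def Isolated (S : Finset V) : Prop := ∀ u ∈ S, ∀ v, G.Adj u v → v ∈ S

variable {G}

theorem Isolated.compl {S : Finset V} (h : Isolated G S) : Isolated G Sᶜ := by
  intro u hu v huv
  rw [mem_compl] at hu ⊢
  exact fun hv => hu (h v hv u huv.symm)

theorem Isolated.isPDS {S : Finset V} (h : Isolated G S) (h2 : 2 ≤ S.card)
    (hN : S.card < Fintype.card V) : IsPDS G S := by
  rw [isPDS_iff]
  refine ⟨h2, hN, fun v hv => ?_⟩
  rw [degIn_eq_univ G (h v hv)]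
  exact Nat.mul_le_mul_left _ (by omega)

variable (G)

/-- A combinatorial form of connectedness of the subgraph induced by `S`. -/
def ConnSet (S : Finset V) : Prop :=
  S.Nonempty ∧ ∀ X ⊆ S, X.Nonempty → (∀ u ∈ X, ∀ v ∈ S, G.Adj u v → v ∈ X) → S ⊆ X

/-- Forward, apply the cut property to the vertices reachable inside S; backward, a relatively
closed set absorbs walks. -/
theorem connSet_iff (S : Finset V) : ConnSet G S ↔ (G.induce (S : Set V)).Connected := by
  constructor
  · rintro ⟨⟨x, hx⟩, h⟩
    rw [SimpleGraph.connected_iff_exists_forall_reachable]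
    refine ⟨⟨x, hx⟩, fun y => ?_⟩
    have := h (S.filter fun v => ∃ hv : v ∈ S, (G.induce (S : Set V)).Reachable ⟨x, hx⟩ ⟨v, hv⟩)
      (filter_subset _ _) ⟨x, by simp [hx]⟩ ?_ y.2
    · obtain ⟨-, _, h⟩ := mem_filter.1 this
      exact h
    · intro u hu v hv huv
      obtain ⟨hu, _, hr⟩ := mem_filter.1 hu
      exact mem_filter.2 ⟨hv, hv, hr.trans (SimpleGraph.Adj.reachable (by simpa using huv))⟩
  · intro h
    obtain ⟨x, hx⟩ := h.nonempty
    refine ⟨⟨x, hx⟩, fun X hX ⟨z, hz⟩ hcl y hy => ?_⟩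
    obtain ⟨w⟩ := h.preconnected ⟨z, hX hz⟩ ⟨y, hy⟩
    have key : ∀ (u v : (S : Set V)), (G.induce (S : Set V)).Walk u v → (u : V) ∈ X → (v : V) ∈ X := by
      intro u v w
      induction w with
      | nil => exact id
      | cons hadj _ ih => exact fun hu => ih (hcl _ hu _ (Subtype.prop _) (by simpa using hadj))
    exact key _ _ w hz

/-- The sets sought: PDS, which moreover have to be connected if `conn` is `true`. -/
def Target (conn : Bool) (S : Finset V) : Prop := IsPDS G S ∧ (conn = true → ConnSet G S)

theorem target_false (S : Finset V) : Target G false S ↔ IsPDS G S := by simp [Target]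

theorem target_true (S : Finset V) : Target G true S ↔ IsConnectedPDS G S := by
  simp [Target, IsConnectedPDS, connSet_iff]

variable {G}

theorem ConnSet.singleton (v : V) : ConnSet G {v} :=
  ⟨by simp, fun X hX hne _ => by
    rcases subset_singleton_iff.1 hX with rfl | rfl
    · simp at hne
    · exact subset_rfl⟩

/-- A nonempty relatively closed subset of T meets S or contains a neighbour of `u`; either way it
contains `u`, hence S, hence all of T. -/
theorem ConnSet.of_nbrs {S T : Finset V}
    (h : ConnSet G S) {u : V} (hu : u ∈ S) (hST : S ⊆ T) (hT : ∀ v ∈ T, v ∈ S ∨ G.Adj u v) :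
    ConnSet G T := by
  refine ⟨⟨u, hST hu⟩, fun X hX ⟨x, hx⟩ hcl => ?_⟩
  have hsub : (X ∩ S).Nonempty → S ⊆ X := fun hne => Finset.Subset.trans
    (h.2 (X ∩ S) Finset.inter_subset_right hne (fun x hx y hy hxy => Finset.mem_inter.2
      ⟨hcl x (Finset.mem_inter.1 hx).1 y (hST hy) hxy, hy⟩)) Finset.inter_subset_left
  have huX : u ∈ X := by
    rcases hT x (hX hx) with hxS | hxu
    · exact hsub ⟨x, Finset.mem_inter.2 ⟨hx, hxS⟩⟩ hu
    · exact hcl x hx u (hST hu) hxu.symm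
  intro v hv
  rcases hT v hv with hvS | huv
  · exact hsub ⟨u, Finset.mem_inter.2 ⟨huX, hu⟩⟩ hvS
  · exact hcl u huX v hv huv

/-- A connected set meeting a proper isolated set lies in a proper connected isolated set. -/
theorem ConnSet.exists_isolated {S Z : Finset V} (h : ConnSet G S) (hZ : Isolated G Z)
    (hne : Z.Nonempty) (hproper : Z ≠ univ) :
    ∃ X, S ⊆ X ∧ ConnSet G X ∧ Isolated G X ∧ X.card < Fintype.card V := by
  obtain ⟨x, hx⟩ := h.1
  -- The witness is the component of a vertex of S. If it were the whole graph, the nonempty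
  -- isolated set `Z` would be everything.
  have hrefl : x ∈ univ.filter (G.Reachable x) := by simp
  have hiso : Isolated G (univ.filter (G.Reachable x)) := by
    intro u hu v huv
    simp only [mem_filter, mem_univ, true_and] at hu ⊢
    exact hu.trans huv.reachable
  have hmin : ∀ Y : Finset V, Isolated G Y → ∀ u v, G.Reachable u v → u ∈ Y → v ∈ Y := by
    rintro Y hY u v ⟨w⟩
    induction w with
    | nil => exact id
    | cons hadj _ ih => exact fun hu => ih (hY _ hu _ hadj)
  refine ⟨univ.filter (G.Reachable x), ?_, ⟨⟨x, hrefl⟩, ?_⟩, hiso, ?_⟩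
  · refine Subset.trans (h.2 (S ∩ univ.filter (G.Reachable x)) inter_subset_left
      ⟨x, mem_inter.2 ⟨hx, hrefl⟩⟩ fun u hu v hv huv => ?_) inter_subset_right
    exact mem_inter.2 ⟨hv, hiso u (mem_inter.1 hu).2 v huv⟩
  · rintro Y hY ⟨y, hy⟩ hcl z hz
    have hYi : Isolated G Y := fun u hu v huv => hcl u hu v (hiso u (hY hu) v huv) huv
    have hyx := hY hy
    simp only [mem_filter, mem_univ, true_and] at hyx hz
    exact hmin Y hYi y z (hyx.symm.trans hz) hy
  · rw [← card_univ]
    refine card_lt_card (ssubset_univ_iff.2 fun hall => ?_)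
    have hall' : ∀ z, G.Reachable x z := fun z => by
      have : z ∈ univ.filter (G.Reachable x) := by rw [hall]; exact mem_univ z
      simpa using this
    obtain ⟨z, hz⟩ := hne
    exact hproper (eq_univ_of_forall fun y => hmin Z hZ z y ((hall' z).symm.trans (hall' y)) hz)

variable (G)

/-- A third vertex of degree at least 3 would, by the choice of `a` and `b`, give three such
vertices and h-index at least 3. -/
theorem degIn_le_two_of_hIndex {a b : V} (hab : a ≠ b)
    (ha : ∀ v, degIn G univ v ≤ degIn G univ a)
    (hb : ∀ v, v ≠ a → degIn G univ v ≤ degIn G univ b) (h : hIndex G ≤ 2)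
    (v : V) (hva : v ≠ a) (hvb : v ≠ b) : degIn G univ v ≤ 2 := by
  by_contra! hv
  have h1 := hb v hva
  have h2 := ha b
  have h3 : 3 ≤ (univ.filter fun v : V => 3 ≤ degIn G univ v).card := by
    have : ({a, b, v} : Finset V) ⊆ univ.filter fun v : V => 3 ≤ degIn G univ v := by
      intro x hx
      simp only [mem_insert, mem_singleton] at hx
      rcases hx with rfl | rfl | rfl <;> simp <;> omega
    calc 3 = ({a, b, v} : Finset V).card := by
            rw [card_insert_of_notMem, card_pair hvb.symm]
            simp [hab, hva.symm]
      _ ≤ _ := card_le_card this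
  have h4 : 3 ≤ hIndex G :=
    le_csSup ⟨Fintype.card V, fun h hh => le_trans hh (card_le_univ _)⟩ h3
  omega

/-- All neighbours of the members of `S` other than `a` and `b` belong to `S`. -/
def NbrClosed (a b : V) (S : Finset V) : Prop :=
  ∀ v ∈ S, v ≠ a → v ≠ b → ∀ u, G.Adj v u → u ∈ S

variable {G} {a b : V}

theorem Isolated.nbrClosed {S : Finset V} (h : Isolated G S) : NbrClosed G a b S :=
  fun v hv _ _ => h v hv

/-- The size bound says 2(|S|-1) > n-1, so v has more than half of its neighbours in S if it has
any; with at most two neighbours this means all of them. -/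
theorem nbrClosed_of_large (hdeg : ∀ v, v ≠ a → v ≠ b → degIn G univ v ≤ 2) {S : Finset V}
    (hS : IsPDS G S) (hlarge : Fintype.card V + 1 < 2 * S.card) : NbrClosed G a b S := by
  intro v hv hva hvb u huv
  obtain ⟨h2, hN, h⟩ := (isPDS_iff G S).1 hS
  have h := h v hv
  have hd := hdeg v hva hvb
  have hle := degIn_mono G (subset_univ S) v
  refine mem_of_degIn_eq_univ G ?_ huv
  obtain ⟨s, hs⟩ : ∃ s, S.card = s + 1 := ⟨S.card - 1, by omega⟩
  obtain ⟨k, hk⟩ : ∃ k, Fintype.card V = k + 1 := ⟨Fintype.card V - 1, by omega⟩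
  rw [hs, hk] at h hlarge
  simp only [Nat.add_sub_cancel] at h
  -- Once both degrees are fixed, the product inequality is linear.
  interval_cases degIn G univ v <;> interval_cases degIn G S v <;> omega

theorem NbrClosed.isPDS {S : Finset V} (h : NbrClosed G a b S) (h2 : 2 ≤ S.card)
    (hN : S.card < Fintype.card V)
    (ha : a ∈ S → degIn G univ a * (S.card - 1) ≤ degIn G S a * (Fintype.card V - 1))
    (hb : b ∈ S → degIn G univ b * (S.card - 1) ≤ degIn G S b * (Fintype.card V - 1)) :
    IsPDS G S := by
  refine (isPDS_iff G S).2 ⟨h2, hN, fun v hv => ?_⟩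
  by_cases hva : v = a
  · exact hva ▸ ha (hva ▸ hv)
  by_cases hvb : v = b
  · exact hvb ▸ hb (hvb ▸ hv)
  rw [degIn_eq_univ G (h v hv hva hvb)]
  exact Nat.mul_le_mul_left _ (by omega)

/-- A bound for all targets follows from a bound for the closed ones and for the size
`⌈n / 2⌉`, unless the graph is disconnected. -/
theorem card_le_of_nbrClosed (hdeg : ∀ v, v ≠ a → v ≠ b → degIn G univ v ≤ 2)
    (hV : 3 ≤ Fintype.card V) {conn : Bool}
    {best : ℕ} (hcl : ∀ S, NbrClosed G a b S → Target G conn S → S.card ≤ best)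
    (hhalf : (Fintype.card V + 1) / 2 ≤ best ∨ ∃ Z, Isolated G Z ∧ Z.Nonempty ∧ Z ≠ univ) :
    (∀ S, Target G conn S → S.card ≤ best) ∧ (conn = false → best ≠ 0) := by
  -- Both an isolated set and its complement are closed, and the larger one has at least ⌈n/2⌉ ≥ 2
  -- vertices.
  have hiso : ∀ Z, Isolated G Z → Z.Nonempty → Z ≠ univ → conn = false →
      (Fintype.card V + 1) / 2 ≤ best := by
    rintro Z hZ hne hproper rfl
    have h1 : Z.card < Fintype.card V := by
      rw [← card_univ]; exact card_lt_card (ssubset_univ_iff.2 hproper)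
    have h2 : 0 < Z.card := card_pos.2 hne
    have h3 := card_compl Z
    by_cases h4 : (Fintype.card V + 1) / 2 ≤ Z.card
    · exact h4.trans (hcl Z hZ.nbrClosed
        ((target_false G Z).2 (hZ.isPDS (by omega) h1)))
    · have h5 : (Fintype.card V + 1) / 2 ≤ Zᶜ.card := by omega
      exact h5.trans (hcl _ hZ.compl.nbrClosed
        ((target_false G _).2 (hZ.compl.isPDS (by omega) (by omega))))
  constructor
  · intro S hS
    by_cases hlarge : Fintype.card V + 1 < 2 * S.card
    · exact hcl S (nbrClosed_of_large hdeg hS.1 hlarge) hS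
    rcases hhalf with h | ⟨Z, hZ, hne, hproper⟩
    · omega
    cases conn with
    | false => have := hiso Z hZ hne hproper rfl; omega
    | true =>
      -- `Z` need not be connected, so S is enlarged to its component instead, which is closed and
      -- still a proper subset.
      obtain ⟨X, hSX, hX, hXi, hXc⟩ := (hS.2 rfl).exists_isolated hZ hne hproper
      have := card_le_card hSX
      exact this.trans (hcl X hXi.nbrClosed ⟨hXi.isPDS (hS.1.1.trans this) hXc, fun _ => hX⟩)
  · intro hc
    rcases hhalf with h | ⟨Z, hZ, hne, hproper⟩
    · omega
    · have := hiso Z hZ hne hproper hc; omega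

/-- A connected set of size `⌈n / 2⌉` that contains `a` but not `b` and as many neighbours of `a`
as possible is a PDS. -/
theorem ConnSet.isPDS_half (hdeg : ∀ v, v ≠ a → v ≠ b → degIn G univ v ≤ 2)
    (hV : 3 ≤ Fintype.card V) {S : Finset V} (h : ConnSet G S) (ha : a ∈ S) (hb : b ∉ S)
    (hcard : S.card = (Fintype.card V + 1) / 2)
    (hnb : (∀ v, G.Adj a v → v = b ∨ v ∈ S) ∨ S.card ≤ degIn G S a + 1) : IsPDS G S := by
  -- A vertex without neighbours in S would be a relatively closed singleton, against connectedness
  -- and |S| ≥ 2.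
  have hpos : ∀ v ∈ S, 0 < degIn G S v := by
    intro v hv
    rw [degIn_pos]
    by_contra! hno
    have := card_le_card (h.2 {v} (by simpa using hv) (by simp)
      (fun u hu w hw huw => absurd (by simp at hu; exact hu ▸ huw) (hno w hw)))
    simp at this
    omega
  refine (isPDS_iff G S).2 ⟨by omega, by omega, fun v hv => ?_⟩
  have hp := hpos v hv
  -- The required inner fraction is at most 1/2. A vertex of degree at most 2 meets it with one
  -- inner neighbour, and so does `a` when it misses at most `b`, since then d ≤ d_S + 1 ≤ 2 d_S.
  have hb' : 2 * (S.card - 1) ≤ Fintype.card V - 1 := by omega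
  by_cases hva : v = a
  · subst hva
    rcases hnb with hnb | hnb
    · have h1 : degIn G univ v ≤ degIn G S v + 1 := by
        calc degIn G univ v ≤ degIn G (Insert.insert b S) v := by
              refine card_le_card fun w hw => ?_
              simp only [mem_filter, mem_univ, true_and, mem_insert] at hw ⊢
              exact ⟨hnb w hw, hw⟩
          _ ≤ _ := by
              unfold degIn
              rw [filter_insert]
              split_ifs
              · exact card_insert_le _ _
              · omega
      generalize degIn G S v = d at *
      generalize degIn G univ v = e at *
      calc e * (S.card - 1) ≤ (2 * d) * (S.card - 1) := Nat.mul_le_mul_right _ (by omega)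
        _ = d * (2 * (S.card - 1)) := by ring
        _ ≤ _ := Nat.mul_le_mul_left _ hb'
    -- Here all other members of S are neighbours of `a`, so d_S ≥ |S|-1, and d ≤ n-1 always holds.
    · have h1 : degIn G univ v ≤ Fintype.card V - 1 := by
        have : univ.filter (fun w => G.Adj v w) ⊆ univ.erase v := by
          intro w hw
          simp only [mem_filter, mem_univ, true_and, mem_erase, and_true] at hw ⊢
          exact hw.ne'
        simpa [degIn] using card_le_card this
      calc _ ≤ (Fintype.card V - 1) * degIn G S v := Nat.mul_le_mul h1 (by omega)
        _ = _ := mul_comm _ _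
  · calc _ ≤ 2 * (S.card - 1) := Nat.mul_le_mul_right _ (hdeg v hva (fun e => hb (e ▸ hv)))
      _ ≤ 1 * (Fintype.card V - 1) := by omega
      _ ≤ _ := Nat.mul_le_mul_right _ hp

/-- Sets that contain one of `a`, `b` and are closed under neighbours other than the other one
reach size `⌈n / 2⌉` unless the graph is disconnected. -/
theorem exists_isolated_of_small {S T : Finset V} (haS : a ∈ S) (hbT : b ∈ T)
    (hS : ∀ u ∈ S, ∀ v, G.Adj u v → v = b ∨ v ∈ S) (hT : ∀ u ∈ T, ∀ v, G.Adj u v → v = a ∨ v ∈ T)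
    (hSc : S.card < (Fintype.card V + 1) / 2) (hTc : T.card < (Fintype.card V + 1) / 2) :
    ∃ Z, Isolated G Z ∧ Z.Nonempty ∧ Z ≠ univ := by
  refine ⟨S ∪ T, fun u hu v huv => ?_, ⟨a, mem_union_left _ haS⟩, fun h => ?_⟩
  · rcases mem_union.1 hu with hu | hu
    · rcases hS u hu v huv with rfl | h
      · exact mem_union_right _ hbT
      · exact mem_union_left _ h
    · rcases hT u hu v huv with rfl | h
      · exact mem_union_left _ haS
      · exact mem_union_right _ h
  · have := card_union_le S T
    rw [h, card_univ] at this
    omega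

end PDS

/-! ### Closed sets as unions of pieces -/

section Pieces

open Finset
open scoped Classical

variable {n : ℕ} (G : SimpleGraph (Fin n)) (a b : Fin n) (lab : Fin n → ℕ)

/-- `X` is closed under adjacency in the graph with `a` and `b` deleted. -/
def LocClosed (X : Finset (Fin n)) : Prop :=
  ∀ u ∈ X, ∀ v, G.Adj u v → u ≠ a → u ≠ b → v ≠ a → v ≠ b → v ∈ X

/-- The values of `lab` distinguish the components of the graph with `a` and `b` deleted
(the pieces). -/
structure IsLabelling : Prop where
  lt : ∀ v, lab v < n
  adj : ∀ u v, G.Adj u v → u ≠ a → u ≠ b → v ≠ a → v ≠ b → lab u = lab v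
  sep : ∀ X, LocClosed G a b X → ∀ u v, lab u = lab v → u ∈ X → v ∈ X

/-- The part of `S` outside `{a, b}`. -/
noncomputable def core (S : Finset (Fin n)) : Finset (Fin n) := S.filter fun v => v ≠ a ∧ v ≠ b

/-- The piece with label `i`. -/
noncomputable def piece (i : ℕ) : Finset (Fin n) :=
  univ.filter fun v => v ≠ a ∧ v ≠ b ∧ lab v = i

/-- The weight of a vertex encodes its adjacency to `a` and `b`. -/
noncomputable def vertexWeight (v : Fin n) : ℕ :=
  1 + n * (if G.Adj a v then 1 else 0) + n ^ 2 * (if G.Adj b v then 1 else 0)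

/-- The weight of a piece. -/
noncomputable def pieceWeight (i : ℕ) : ℕ := ∑ v ∈ piece a b lab i, vertexWeight G a b v

theorem mem_core {S : Finset (Fin n)} {v : Fin n} :
    v ∈ core a b S ↔ v ∈ S ∧ v ≠ a ∧ v ≠ b := by simp [core]

theorem mem_piece {i : ℕ} {v : Fin n} :
    v ∈ piece a b lab i ↔ v ≠ a ∧ v ≠ b ∧ lab v = i := by simp [piece]

theorem sum_vertexWeight (S : Finset (Fin n)) :
    ∑ v ∈ S, vertexWeight G a b v = S.card + n * degIn G S a + n ^ 2 * degIn G S b := by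
  simp only [vertexWeight, sum_add_distrib, ← mul_sum, degIn, sum_boole, sum_const, smul_eq_mul,
    mul_one, Nat.cast_id]

theorem pieceWeight_eq (i : ℕ) : pieceWeight G a b lab i = (piece a b lab i).card +
    n * degIn G (piece a b lab i) a + n ^ 2 * degIn G (piece a b lab i) b :=
  sum_vertexWeight G a b _

/-- A label-saturated set is, outside `a` and `b`, a disjoint union of pieces, so its size and its
two degree counts are obtained by adding piece weights. -/
theorem sum_pieceWeight {S : Finset (Fin n)} {I : Finset ℕ}
    (h : ∀ v, v ≠ a → v ≠ b → (v ∈ S ↔ lab v ∈ I)) :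
    ∑ i ∈ I, pieceWeight G a b lab i = (core a b S).card +
      n * degIn G (core a b S) a + n ^ 2 * degIn G (core a b S) b := by
  rw [← sum_vertexWeight, ← sum_fiberwise_of_maps_to (t := I) (g := lab)]
  · refine sum_congr rfl fun i hi => sum_congr ?_ fun _ _ => rfl
    ext v
    simp only [mem_piece, mem_filter, mem_core]
    constructor
    · rintro ⟨hva, hvb, rfl⟩
      exact ⟨⟨(h v hva hvb).2 hi, hva, hvb⟩, rfl⟩
    · rintro ⟨⟨-, hva, hvb⟩, rfl⟩
      exact ⟨hva, hvb, rfl⟩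
  · intro v hv
    obtain ⟨hvS, hva, hvb⟩ := (mem_core a b).1 hv
    exact (h v hva hvb).1 hvS

/-- The leading coefficient `z` is not bounded. The last clause, without reduction modulo `n`,
matches the test in `bonus`. -/
theorem digits {n s x y z : ℕ} (hs : s < n) (hx : x < n) (hy : y < n) :
    (s + n * x + n ^ 2 * y + n ^ 3 * z) % n = s ∧
    (s + n * x + n ^ 2 * y + n ^ 3 * z) / n % n = x ∧
    (s + n * x + n ^ 2 * y + n ^ 3 * z) / n ^ 2 % n = y ∧
    (s + n * x + n ^ 2 * y + n ^ 3 * z) / n ^ 3 = z ∧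
    (s + n * x + n ^ 2 * y + n ^ 3 * z) / n ^ 2 = y + n * z := by
  have hn : 0 < n := by omega
  have e1 : s + n * x + n ^ 2 * y + n ^ 3 * z = s + n * (x + n * (y + n * z)) := by ring
  have d1 : (s + n * x + n ^ 2 * y + n ^ 3 * z) / n = x + n * (y + n * z) := by
    rw [e1, Nat.add_mul_div_left _ _ hn, Nat.div_eq_of_lt hs, zero_add]
  have d2 : (s + n * x + n ^ 2 * y + n ^ 3 * z) / n ^ 2 = y + n * z := by
    rw [sq n, ← Nat.div_div_eq_div_mul, ← sq n, d1, Nat.add_mul_div_left _ _ hn,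
      Nat.div_eq_of_lt hx, zero_add]
  refine ⟨?_, ?_, ?_, ?_, d2⟩
  · rw [e1, Nat.add_mul_mod_self_left, Nat.mod_eq_of_lt hs]
  · rw [d1, Nat.add_mul_mod_self_left, Nat.mod_eq_of_lt hx]
  · rw [d2, Nat.add_mul_mod_self_left, Nat.mod_eq_of_lt hy]
  · have e3 : ∀ k, k / n ^ 3 = k / n ^ 2 / n := fun k => by
      rw [Nat.div_div_eq_div_mul, ← pow_succ]
    rw [e3, d2, Nat.add_mul_div_left _ _ hn,
      Nat.div_eq_of_lt hy, zero_add]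

variable {a b}

/-- Leaving out two vertices keeps the size and both degree counts below `n`, so adding piece
weights never produces a carry. -/
theorem card_core_le (hab : a ≠ b) (S : Finset (Fin n)) : (core a b S).card + 2 ≤ n := by
  have h : core a b S ⊆ ({a, b} : Finset (Fin n))ᶜ := by
    intro v hv
    simpa using ((mem_core a b).1 hv).2
  have h1 := card_le_card h
  have h2 := card_add_card_compl ({a, b} : Finset (Fin n))
  rw [card_pair hab, Fintype.card_fin] at h2
  omega

theorem card_eq_core (hab : a ≠ b) (S : Finset (Fin n)) :
    S.card = (decide (a ∈ S)).toNat + (decide (b ∈ S)).toNat + (core a b S).card := by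
  have h1 : core a b S = (S.erase a).erase b := by ext v; simp [core]; tauto
  rw [h1]
  by_cases ha : a ∈ S <;> by_cases hb : b ∈ S
  · have hb' : b ∈ S.erase a := mem_erase.2 ⟨hab.symm, hb⟩
    have := card_erase_add_one ha
    have := card_erase_add_one hb'
    simp [ha, hb]; omega
  · have := card_erase_add_one ha
    rw [erase_eq_of_notMem (a := b) (by simp [hb])]
    simp [ha, hb]; omega
  · have := card_erase_add_one hb
    rw [erase_eq_of_notMem ha]
    simp [ha, hb]; omega
  · rw [erase_eq_of_notMem ha, erase_eq_of_notMem hb]; simp [ha, hb]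

theorem degIn_eq_core (S : Finset (Fin n)) :
    degIn G S a = degIn G (core a b S) a + (if b ∈ S then if G.Adj a b then 1 else 0 else 0) := by
  have h0 : (core a b S).filter (fun w => G.Adj a w) =
      (S.filter (fun w => G.Adj a w)).erase b := by
    ext v
    simp only [mem_filter, mem_core, mem_erase]
    constructor
    · tauto
    · rintro ⟨h1, h2, h3⟩; exact ⟨⟨h2, h3.ne', h1⟩, h3⟩
  unfold degIn
  rw [h0]
  by_cases hb : b ∈ S ∧ G.Adj a b
  · rw [if_pos hb.1, if_pos hb.2, card_erase_add_one (by simp [hb])]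
  · rw [erase_eq_of_notMem (by simpa using hb)]
    split_ifs <;> simp_all

theorem core_comm (S : Finset (Fin n)) : core a b S = core b a S := by
  ext v; simp [core]; tauto

variable (a b)

/-- The bonus digit of a piece of weight `w` counts, in the connected version, pieces adjacent to
both of `a` and `b`, or all pieces if neither `a` nor `b` is selected. -/
def bonus (conn fa fb : Bool) (n w : ℕ) : ℕ :=
  if conn then
    if fa || fb then (if 0 < w / n % n ∧ 0 < w / n ^ 2 then 1 else 0)
    else (if 0 < w then 1 else 0)
  else 0

/-- The weight of an item: in the connected version, pieces adjacent to neither `a` nor `b` are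
ruled out by weight `0` if one of `a` and `b` is selected. -/
def itemWeight (conn fa fb : Bool) (n w : ℕ) : ℕ :=
  if conn && (fa || fb) && decide (w < n) then 0 else w + n ^ 3 * bonus conn fa fb n w

/-- The condition on a total weight `w` under which the union of the selected pieces and of those
of `a` and `b` that are selected (`fa`, `fb`) is a target; `e` is `1` if `a` and `b` are adjacent
and `0` otherwise, `da` and `db` are the degrees. -/
def Good (conn fa fb : Bool) (n e da db w : ℕ) : Prop :=
  2 ≤ fa.toNat + fb.toNat + w % n ∧ fa.toNat + fb.toNat + w % n < n ∧
  (if fa then da * (fa.toNat + fb.toNat + w % n - 1) ≤ (w / n % n + e * fb.toNat) * (n - 1)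
    else w / n % n = 0) ∧
  (if fb then db * (fa.toNat + fb.toNat + w % n - 1) ≤ (w / n ^ 2 % n + e * fa.toNat) * (n - 1)
    else w / n ^ 2 % n = 0) ∧
  (conn = true → (fa = true → fb = true → 0 < e + w / n ^ 3) ∧
    (fa = false → fb = false → w / n ^ 3 = 1))

variable {G a b lab}

/-- The program sees a piece only through its weight. Since a piece has fewer than `n` vertices, the
weight reaches `n` exactly when an adjacency digit is nonzero. -/
theorem pieceWeight_digits (hab : a ≠ b) (i : ℕ) :
    (n ≤ pieceWeight G a b lab i ↔ ∃ u ∈ piece a b lab i, G.Adj a u ∨ G.Adj b u) ∧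
    (0 < pieceWeight G a b lab i / n % n ↔ ∃ u ∈ piece a b lab i, G.Adj a u) ∧
    (0 < pieceWeight G a b lab i / n ^ 2 ↔ ∃ u ∈ piece a b lab i, G.Adj b u) ∧
    (0 < pieceWeight G a b lab i ↔ (piece a b lab i).Nonempty) := by
  have hc : core a b (piece a b lab i) = piece a b lab i := by
    ext v; simp only [mem_core, mem_piece]; tauto
  have h1 := card_core_le hab (piece a b lab i)
  rw [hc] at h1
  have h2 := degIn_le_card G (piece a b lab i) a
  have h3 := degIn_le_card G (piece a b lab i) b
  have hn : 0 < n := by omega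
  obtain ⟨-, hx, -, -, hy⟩ := digits (n := n) (z := 0) (show (piece a b lab i).card < n by omega)
    (show degIn G (piece a b lab i) a < n by omega) (show degIn G (piece a b lab i) b < n by omega)
  rw [mul_zero, add_zero, ← pieceWeight_eq] at hx hy
  rw [mul_zero, add_zero] at hy
  refine ⟨?_, ?_, ?_, ?_⟩
  · rw [pieceWeight_eq]
    constructor
    · intro h
      by_contra! h0
      have ha : degIn G (piece a b lab i) a = 0 := (degIn_eq_zero G).2 fun u hu => (h0 u hu).1
      have hb : degIn G (piece a b lab i) b = 0 := (degIn_eq_zero G).2 fun u hu => (h0 u hu).2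
      rw [ha, hb] at h; omega
    · rintro ⟨u, hu, h | h⟩
      · have : 0 < degIn G (piece a b lab i) a := (degIn_pos G).2 ⟨u, hu, h⟩
        nlinarith [Nat.zero_le (n ^ 2 * degIn G (piece a b lab i) b)]
      · have : 0 < degIn G (piece a b lab i) b := (degIn_pos G).2 ⟨u, hu, h⟩
        nlinarith [Nat.zero_le (n * degIn G (piece a b lab i) a), sq n, Nat.le_self_pow two_ne_zero n,
          Nat.le_mul_of_pos_right (n ^ 2) this]
  · rw [hx, degIn_pos]
  · rw [hy, degIn_pos]
  · rw [pieceWeight_eq, ← card_pos]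
    constructor
    · intro h
      by_contra! h0
      have ha : degIn G (piece a b lab i) a = 0 := by omega
      have hb : degIn G (piece a b lab i) b = 0 := by omega
      rw [ha, hb] at h; omega
    · omega

/-- A relatively closed subset of a closed set is closed in G - {a, b}, so `sep` applies to it. With
`X = S`, a closed set is a union of label classes. -/
theorem NbrClosed.mem_of_lab {S : Finset (Fin n)} (hlab : IsLabelling G a b lab)
    {X : Finset (Fin n)} (hX : X ⊆ S) (hS : NbrClosed G a b S)
    (hcl : ∀ u ∈ X, ∀ v ∈ S, G.Adj u v → v ∈ X) {u v : Fin n} (h : lab u = lab v)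
    (hu : u ∈ X) : v ∈ X :=
  hlab.sep X (fun x hx y hxy hxa hxb _ _ => hcl x hx y (hS x (hX hx) hxa hxb y hxy) hxy) u v h hu

/-- Connectedness of a closed set in terms of its pieces. -/
theorem connSet_iff_pieces (hab : a ≠ b) (hlab : IsLabelling G a b lab) {S : Finset (Fin n)}
    (hS : NbrClosed G a b S) (hne : S.Nonempty) : ConnSet G S ↔
    (a ∈ S ∨ b ∈ S → ∀ v ∈ core a b S, ∃ u ∈ piece a b lab (lab v), G.Adj a u ∨ G.Adj b u) ∧
    (a ∈ S → b ∈ S → G.Adj a b ∨ ∃ w ∈ core a b S, (∃ u ∈ piece a b lab (lab w), G.Adj a u) ∧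
      ∃ u ∈ piece a b lab (lab w), G.Adj b u) ∧
    (a ∉ S → b ∉ S → ∀ u ∈ core a b S, ∀ v ∈ core a b S, lab u = lab v) := by
  have hfib : ∀ {u v}, lab u = lab v → u ∈ S → v ∈ S := fun h hu =>
    hS.mem_of_lab hlab subset_rfl (fun _ _ _ h _ => h) h hu
  constructor
  · intro hc
    refine ⟨fun hor v hv => ?_, fun ha hb => ?_, fun ha hb u hu v hv => ?_⟩
    · by_contra! hno
      -- A piece touching neither `a` nor `b` is relatively closed, so by connectedness it would
      -- contain whichever of them is in S.
      have := hc.2 ((core a b S).filter fun w => lab w = lab v)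
        ((filter_subset _ _).trans (filter_subset _ _)) ⟨v, by simp [hv]⟩ ?_
      · rcases hor with h | h <;> have := this h <;> simp [mem_core] at this
      · intro u hu w hw huw
        simp only [mem_filter, mem_core] at hu ⊢
        have hup : u ∈ piece a b lab (lab v) := (mem_piece _ _ _).2 ⟨hu.1.2.1, hu.1.2.2, hu.2⟩
        have hwa : w ≠ a := by rintro rfl; exact (hno u hup).1 huw.symm
        have hwb : w ≠ b := by rintro rfl; exact (hno u hup).2 huw.symm
        exact ⟨⟨hw, hwa, hwb⟩, by rw [← hu.2, hlab.adj u w huw hu.1.2.1 hu.1.2.2 hwa hwb]⟩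
    · by_contra! hno
      -- Without the edge ab and without a piece touching both, `a` together with the pieces at `a`
      -- is relatively closed and misses `b`.
      have := hc.2 (insert a ((core a b S).filter fun w => ∃ u ∈ piece a b lab (lab w), G.Adj a u))
        (insert_subset ha ((filter_subset _ _).trans (filter_subset _ _))) (by simp) ?_ hb
      · simp [mem_core, hab.symm] at this
      · intro u hu w hw huw
        simp only [mem_insert, mem_filter, mem_core] at hu ⊢
        by_cases hwa : w = a
        · exact Or.inl hwa
        refine Or.inr ?_
        rcases hu with rfl | ⟨⟨huS, hua, hub⟩, hx⟩
        · have hwb : w ≠ b := by rintro rfl; exact hno.1 huw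
          exact ⟨⟨hw, hwa, hwb⟩, w, (mem_piece _ _ _).2 ⟨hwa, hwb, rfl⟩, huw⟩
        · have hwb : w ≠ b := by
            rintro rfl
            exact hno.2 u ((mem_core _ _).2 ⟨huS, hua, hub⟩) hx u
              ((mem_piece _ _ _).2 ⟨hua, hub, rfl⟩) huw.symm
          exact ⟨⟨hw, hwa, hwb⟩, by rwa [← hlab.adj u w huw hua hub hwa hwb]⟩
    · have := hc.2 ((core a b S).filter fun w => lab w = lab v)
        ((filter_subset _ _).trans (filter_subset _ _)) ⟨v, by simp [hv]⟩ ?_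
        ((mem_core a b).1 hu).1
      · exact (mem_filter.1 this).2
      · intro u hu w hw huw
        simp only [mem_filter, mem_core] at hu ⊢
        have hwa : w ≠ a := by rintro rfl; exact ha hw
        have hwb : w ≠ b := by rintro rfl; exact hb hw
        exact ⟨⟨hw, hwa, hwb⟩, by rw [← hu.2, hlab.adj u w huw hu.1.2.1 hu.1.2.2 hwa hwb]⟩
  · rintro ⟨h1, h2, h3⟩
    refine ⟨hne, fun X hX ⟨x, hx⟩ hcl => ?_⟩
    have hXfib : ∀ {u v}, lab u = lab v → u ∈ X → v ∈ X := fun h hu =>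
      hS.mem_of_lab hlab hX hcl h hu
    have hpS : ∀ {v u : Fin n}, v ∈ core a b S → u ∈ piece a b lab (lab v) → u ∈ S :=
      fun hv hu => hfib ((mem_piece _ _ _).1 hu).2.2.symm ((mem_core _ _).1 hv).1
    have haS : ∀ {v u : Fin n}, v ∈ core a b S → u ∈ piece a b lab (lab v) → G.Adj a u → a ∈ S :=
      fun hv hu h => hS _ (hpS hv hu) ((mem_piece _ _ _).1 hu).1 ((mem_piece _ _ _).1 hu).2.1 _ h.symm
    have hbS : ∀ {v u : Fin n}, v ∈ core a b S → u ∈ piece a b lab (lab v) → G.Adj b u → b ∈ S :=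
      fun hv hu h => hS _ (hpS hv hu) ((mem_piece _ _ _).1 hu).1 ((mem_piece _ _ _).1 hu).2.1 _ h.symm
    by_cases hor : a ∈ S ∨ b ∈ S
    -- A relatively closed `X` first captures `a` or `b`, then the other one through the edge or a
    -- common piece, then every piece attached to them.
    · have hX1 : a ∈ X ∨ b ∈ X := by
        by_cases hxa : x = a
        · exact Or.inl (hxa ▸ hx)
        by_cases hxb : x = b
        · exact Or.inr (hxb ▸ hx)
        have hxc : x ∈ core a b S := (mem_core _ _).2 ⟨hX hx, hxa, hxb⟩
        obtain ⟨u, hu, h⟩ := h1 hor x hxc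
        have huX : u ∈ X := hXfib ((mem_piece _ _ _).1 hu).2.2.symm hx
        exact h.imp (fun h => hcl u huX a (haS hxc hu h) h.symm)
          fun h => hcl u huX b (hbS hxc hu h) h.symm
      have hX2 : (a ∈ S → a ∈ X) ∧ (b ∈ S → b ∈ X) := by
        by_cases hboth : a ∈ S ∧ b ∈ S
        · obtain ⟨ha, hb⟩ := hboth
          rcases h2 ha hb with h | ⟨w, hw, ⟨u, hu, hau⟩, v, hv, hbv⟩
          · rcases hX1 with h' | h'
            · exact ⟨fun _ => h', fun _ => hcl a h' b hb h⟩
            · exact ⟨fun _ => hcl b h' a ha h.symm, fun _ => h'⟩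
          · have huv : lab u = lab v := by
              rw [((mem_piece _ _ _).1 hu).2.2, ((mem_piece _ _ _).1 hv).2.2]
            rcases hX1 with h' | h'
            · exact ⟨fun _ => h', fun _ =>
                hcl v (hXfib huv (hcl a h' u (hpS hw hu) hau)) b hb hbv.symm⟩
            · exact ⟨fun _ => hcl u (hXfib huv.symm (hcl b h' v (hpS hw hv) hbv)) a ha hau.symm,
                fun _ => h'⟩
        · rcases hX1 with h | h
          · exact ⟨fun _ => h, fun hb => absurd ⟨hX h, hb⟩ hboth⟩
          · exact ⟨fun ha => absurd ⟨ha, hX h⟩ hboth, fun _ => h⟩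
      intro v hv
      by_cases hva : v = a
      · subst hva; exact hX2.1 hv
      by_cases hvb : v = b
      · subst hvb; exact hX2.2 hv
      have hvc : v ∈ core a b S := (mem_core _ _).2 ⟨hv, hva, hvb⟩
      obtain ⟨u, hu, h | h⟩ := h1 hor v hvc
      · exact hXfib ((mem_piece _ _ _).1 hu).2.2 (hcl a (hX2.1 (haS hvc hu h)) u (hpS hvc hu) h)
      · exact hXfib ((mem_piece _ _ _).1 hu).2.2 (hcl b (hX2.2 (hbS hvc hu h)) u (hpS hvc hu) h)
    · push Not at hor
      intro v hv
      refine hXfib (h3 hor.1 hor.2 x ?_ v ?_) hx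
      · exact (mem_core _ _).2 ⟨hX hx, fun h => hor.1 (h ▸ hX hx), fun h => hor.2 (h ▸ hX hx)⟩
      · exact (mem_core _ _).2 ⟨hv, fun h => hor.1 (h ▸ hv), fun h => hor.2 (h ▸ hv)⟩

end Pieces

/-! ### Targets as subset sums of item weights. -/

section Weights

open Finset
open scoped Classical

variable {n : ℕ} {G : SimpleGraph (Fin n)} {a b : Fin n} {lab : Fin n → ℕ}

theorem itemWeight_eq {conn fa fb : Bool} {n w : ℕ}
    (h : conn = true → (fa || fb) = true → n ≤ w) :
    itemWeight conn fa fb n w = w + n ^ 3 * bonus conn fa fb n w := by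
  unfold itemWeight
  rw [if_neg]
  intro hc
  simp only [Bool.and_eq_true, decide_eq_true_eq] at hc
  have := h hc.1.1 hc.1.2
  omega

theorem le_of_itemWeight_ne_zero {conn fa fb : Bool} {n w : ℕ}
    (h : itemWeight conn fa fb n w ≠ 0) (hc : conn = true) (hf : (fa || fb) = true) : n ≤ w := by
  by_contra! hlt
  exact h (by simp [itemWeight, hc, hf, hlt])

theorem bonus_le_one (conn fa fb : Bool) (n w : ℕ) : bonus conn fa fb n w ≤ 1 := by
  unfold bonus; split_ifs <;> simp

/-- Reads the digits back as properties of S: adding the possible edge ab to the core count recovers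
the degree in S, and a zero digit for an absent `a` or `b` says that no selected piece touches it.
-/
theorem good_iff (hab : a ≠ b) (S : Finset (Fin n)) (conn : Bool) (z : ℕ) :
    Good conn (decide (a ∈ S)) (decide (b ∈ S)) n (if G.Adj a b then 1 else 0)
      (degIn G univ a) (degIn G univ b)
      ((core a b S).card + n * degIn G (core a b S) a + n ^ 2 * degIn G (core a b S) b + n ^ 3 * z) ↔
    2 ≤ S.card ∧ S.card < n ∧
    (if a ∈ S then degIn G univ a * (S.card - 1) ≤ degIn G S a * (n - 1)
      else degIn G (core a b S) a = 0) ∧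
    (if b ∈ S then degIn G univ b * (S.card - 1) ≤ degIn G S b * (n - 1)
      else degIn G (core a b S) b = 0) ∧
    (conn = true → (a ∈ S → b ∈ S → 0 < (if G.Adj a b then 1 else 0) + z) ∧
      (a ∉ S → b ∉ S → z = 1)) := by
  have h1 := card_core_le hab S
  have h2 := degIn_le_card G (core a b S) a
  have h3 := degIn_le_card G (core a b S) b
  obtain ⟨hs, hx, hy, hz, -⟩ := digits (n := n) (z := z) (show (core a b S).card < n by omega)
    (show degIn G (core a b S) a < n by omega) (show degIn G (core a b S) b < n by omega)
  have hb := degIn_eq_core (a := b) (b := a) G S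
  rw [← core_comm, G.adj_comm b a] at hb
  unfold Good
  rw [hs, hx, hy, hz, ← card_eq_core hab S, degIn_eq_core (b := b) G S, hb]
  simp only [decide_eq_true_eq, decide_eq_false_iff_not]
  by_cases ha : a ∈ S <;> by_cases hb : b ∈ S <;> simp [ha, hb]

theorem nbrClosed_of_lab (hlab : IsLabelling G a b lab) {S : Finset (Fin n)} {I : Finset ℕ}
    (h : ∀ v, v ≠ a → v ≠ b → (v ∈ S ↔ lab v ∈ I))
    (ha : a ∉ S → degIn G (core a b S) a = 0) (hb : b ∉ S → degIn G (core a b S) b = 0) :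
    NbrClosed G a b S := by
  intro v hv hva hvb u hvu
  have hvc : v ∈ core a b S := (mem_core _ _).2 ⟨hv, hva, hvb⟩
  by_cases hua : u = a
  · subst hua
    by_contra hn
    exact (degIn_eq_zero G).1 (ha hn) v hvc hvu.symm
  by_cases hub : u = b
  · subst hub
    by_contra hn
    exact (degIn_eq_zero G).1 (hb hn) v hvc hvu.symm
  exact (h u hua hub).2 (hlab.adj v u hvu hva hvb hua hub ▸ (h v hva hvb).1 hv)

/-- The union of the selected pieces is a target if the total weight is good. -/
theorem target_of_good (hab : a ≠ b) (hlab : IsLabelling G a b lab) {conn fa fb : Bool}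
    {I : Finset ℕ} (hI : ∀ i ∈ I, itemWeight conn fa fb n (pieceWeight G a b lab i) ≠ 0)
    {S : Finset (Fin n)} (ha : fa = decide (a ∈ S)) (hb : fb = decide (b ∈ S))
    (hS : ∀ v, v ≠ a → v ≠ b → (v ∈ S ↔ lab v ∈ I)) {w : ℕ}
    (hw : w = ∑ i ∈ I, itemWeight conn fa fb n (pieceWeight G a b lab i))
    (hgood : Good conn fa fb n (if G.Adj a b then 1 else 0) (degIn G univ a) (degIn G univ b) w) :
    Target G conn S ∧ S.card = fa.toNat + fb.toNat + w % n := by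
  have h1 := card_core_le hab S
  have h2 := degIn_le_card G (core a b S) a
  have h3 := degIn_le_card G (core a b S) b
  -- Nonzero item weights rule out the penalty value 0, so the sum splits into piece weights and
  -- bonuses.
  rw [sum_congr rfl fun i hi => itemWeight_eq (le_of_itemWeight_ne_zero (hI i hi)),
    sum_add_distrib, sum_pieceWeight G a b lab hS, ← mul_sum] at hw
  have hmod : w % n = (core a b S).card := by
    rw [hw]
    exact (digits (by omega) (by omega) (by omega)).1
  rw [hw] at hgood
  subst ha hb
  obtain ⟨hc2, hcn, hA, hB, hC⟩ := (good_iff hab S conn _).1 hgood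
  have hcl : NbrClosed G a b S := nbrClosed_of_lab hlab hS (fun h => by rwa [if_neg h] at hA)
    (fun h => by rwa [if_neg h] at hB)
  refine ⟨⟨hcl.isPDS hc2 (by simpa using hcn) (fun h => by rw [if_pos h] at hA; simpa using hA)
    (fun h => by rw [if_pos h] at hB; simpa using hB), fun hconn => ?_⟩, ?_⟩
  · obtain ⟨h11, h00⟩ := hC hconn
    have hlabI : ∀ v ∈ core a b S, lab v ∈ I := fun v hv => by
      obtain ⟨hvS, hva, hvb⟩ := (mem_core _ _).1 hv
      exact (hS v hva hvb).1 hvS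
    refine (connSet_iff_pieces hab hlab hcl (card_pos.1 (by omega))).2 ⟨?_, ?_, ?_⟩
    · intro hor v hv
      exact (pieceWeight_digits hab _).1.1 (le_of_itemWeight_ne_zero (hI _ (hlabI v hv)) hconn
        (by simpa using hor))
    · intro ha hb
      by_cases hadj : G.Adj a b
      · exact Or.inl hadj
      have := h11 ha hb
      rw [if_neg hadj, zero_add] at this
      obtain ⟨i, hi, hpos⟩ := exists_ne_zero_of_sum_ne_zero this.ne'
      have hpos : 0 < pieceWeight G a b lab i / n % n ∧ 0 < pieceWeight G a b lab i / n ^ 2 := by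
        by_contra hno
        exact hpos (by simp only [bonus, hconn, ha, if_neg hno]; simp)
      obtain ⟨u, hu, hau⟩ := (pieceWeight_digits hab i).2.1.1 hpos.1
      obtain ⟨hua, hub, hlu⟩ := (mem_piece _ _ _).1 hu
      refine Or.inr ⟨u, (mem_core _ _).2 ⟨(hS u hua hub).2 (hlu ▸ hi), hua, hub⟩, ?_, ?_⟩ <;>
        rw [hlu]
      · exact ⟨u, hu, hau⟩
      · exact (pieceWeight_digits hab i).2.2.1.1 hpos.2
    · intro ha hb u hu v hv
      have h1 := h00 ha hb
      -- With neither `a` nor `b` selected every chosen item carries bonus 1, so leading digit 1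
      -- means that a single piece is chosen.
      have hone : ∀ i ∈ I, bonus conn (decide (a ∈ S)) (decide (b ∈ S)) n
          (pieceWeight G a b lab i) = 1 := by
        intro i hi
        have hne := hI i hi
        have : 0 < pieceWeight G a b lab i := by
          by_contra! h0
          exact hne (by simp [itemWeight, bonus, ha, hb, Nat.le_zero.1 h0])
        simp [bonus, hconn, ha, hb, this]
      rw [sum_congr rfl hone, ← card_eq_sum_ones] at h1
      exact card_le_one.1 h1.le _ (hlabI u hu) _ (hlabI v hv)
  · rw [hmod, card_eq_core hab S]

/-- Every closed target arises from a selection of pieces with a good total weight. -/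
theorem exists_good (hab : a ≠ b) (hlab : IsLabelling G a b lab) {conn : Bool}
    {S : Finset (Fin n)} (hcl : NbrClosed G a b S) (hT : Target G conn S) {fa fb : Bool}
    (ha : fa = decide (a ∈ S)) (hb : fb = decide (b ∈ S)) :
    ∃ w < n ^ 4, (∃ I ⊆ range n,
        w = ∑ i ∈ I, itemWeight conn fa fb n (pieceWeight G a b lab i)) ∧
      Good conn fa fb n (if G.Adj a b then 1 else 0) (degIn G univ a) (degIn G univ b) w ∧
      S.card = fa.toNat + fb.toNat + w % n := by
  have h1 := card_core_le hab S
  have h2 := degIn_le_card G (core a b S) a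
  have h3 := degIn_le_card G (core a b S) b
  obtain ⟨hc2, hcn, hdeg⟩ := (isPDS_iff G S).1 hT.1
  rw [Fintype.card_fin] at hcn hdeg
  have hne : S.Nonempty := card_pos.1 (by omega)
  have hS : ∀ v, v ≠ a → v ≠ b → (v ∈ S ↔ lab v ∈ (core a b S).image lab) := by
    intro v hva hvb
    rw [mem_image]
    constructor
    · exact fun hv => ⟨v, (mem_core _ _).2 ⟨hv, hva, hvb⟩, rfl⟩
    · rintro ⟨u, hu, h⟩
      exact hcl.mem_of_lab hlab subset_rfl (fun _ _ _ h _ => h) h ((mem_core _ _).1 hu).1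
  have hconn : conn = true → _ := fun h => (connSet_iff_pieces hab hlab hcl hne).1 (hT.2 h)
  have hsum : ∑ i ∈ (core a b S).image lab, itemWeight conn fa fb n (pieceWeight G a b lab i) =
      (core a b S).card + n * degIn G (core a b S) a + n ^ 2 * degIn G (core a b S) b + n ^ 3 *
        ∑ i ∈ (core a b S).image lab, bonus conn fa fb n (pieceWeight G a b lab i) := by
    rw [← sum_pieceWeight G a b lab hS, mul_sum, ← sum_add_distrib]
    refine sum_congr rfl fun i hi => itemWeight_eq fun hc hf => ?_
    obtain ⟨v, hv, rfl⟩ := mem_image.1 hi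
    exact (pieceWeight_digits hab _).1.2 ((hconn hc).1 (by simpa [ha, hb] using hf) v hv)
  -- Each piece contributes at most 1, and there are no more pieces in S than core vertices; hence
  -- the leading digit is below `n` too.
  have hz : ∑ i ∈ (core a b S).image lab, bonus conn fa fb n (pieceWeight G a b lab i) ≤
      (core a b S).card := by
    refine le_trans (sum_le_card_nsmul _ _ 1 fun i _ => bonus_le_one _ _ _ _ _) ?_
    simpa using card_image_le
  refine ⟨_, ?_, ⟨(core a b S).image lab, ?_, rfl⟩, ?_, ?_⟩
  · rw [hsum]
    generalize (∑ i ∈ (core a b S).image lab, bonus conn fa fb n (pieceWeight G a b lab i)) = z at *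
    generalize degIn G (core a b S) a = x at *
    generalize degIn G (core a b S) b = y at *
    generalize (core a b S).card = s at *
    -- Horner's scheme: four digits below `n` give a number below n^4.
    have e1 : z + 1 ≤ n := by omega
    have e2 : y + n * z + 1 ≤ n ^ 2 := by nlinarith
    have e3 : x + n * (y + n * z) + 1 ≤ n ^ 3 := by nlinarith
    have e4 : s + n * (x + n * (y + n * z)) + 1 ≤ n ^ 4 := by nlinarith
    calc s + n * x + n ^ 2 * y + n ^ 3 * z = s + n * (x + n * (y + n * z)) := by ring
      _ < n ^ 4 := e4
  · intro i hi
    obtain ⟨v, -, rfl⟩ := mem_image.1 hi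
    exact mem_range.2 (hlab.lt v)
  · rw [hsum]
    subst ha hb
    refine (good_iff hab S conn _).2 ⟨hc2, hcn, ?_, ?_, fun hc => ⟨fun ha hb => ?_, fun ha hb => ?_⟩⟩
    · split_ifs with h
      · exact hdeg a h
      · refine (degIn_eq_zero G).2 fun u hu hau => h ?_
        obtain ⟨huS, hua, hub⟩ := (mem_core _ _).1 hu
        exact hcl u huS hua hub a hau.symm
    · split_ifs with h
      · exact hdeg b h
      · refine (degIn_eq_zero G).2 fun u hu hau => h ?_
        obtain ⟨huS, hua, hub⟩ := (mem_core _ _).1 hu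
        exact hcl u huS hua hub b hau.symm
    · rcases (hconn hc).2.1 ha hb with h | ⟨v, hv, hva, hvb⟩
      · simp [h]
      · refine Nat.add_pos_right _ (sum_pos' (fun _ _ => Nat.zero_le _)
          ⟨lab v, mem_image_of_mem _ hv, ?_⟩)
        have e1 := (pieceWeight_digits hab _).2.1.2 hva
        have e2 := (pieceWeight_digits hab _).2.2.1.2 hvb
        simp only [bonus, hc, ha]
        simp [e1, e2]
    · have hsame := (hconn hc).2.2 ha hb
      obtain ⟨v, hv⟩ : (core a b S).Nonempty := by
        obtain ⟨v, hv⟩ := hne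
        exact ⟨v, (mem_core _ _).2 ⟨hv, fun h => ha (h ▸ hv), fun h => hb (h ▸ hv)⟩⟩
      have himg : (core a b S).image lab = {lab v} := by
        ext i
        simp only [mem_image, mem_singleton]
        constructor
        · rintro ⟨u, hu, rfl⟩; exact hsame u hu v hv
        · rintro rfl; exact ⟨v, hv, rfl⟩
      have hpos : 0 < pieceWeight G a b lab (lab v) := (pieceWeight_digits hab _).2.2.2.2
        ⟨v, (mem_piece _ _ _).2 ⟨((mem_core _ _).1 hv).2.1, ((mem_core _ _).1 hv).2.2, rfl⟩⟩
      rw [himg, sum_singleton]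
      simp [bonus, hc, ha, hb, hpos]
  · rw [hsum, (digits (by omega) (by omega) (by omega)).1, card_eq_core hab S, ha, hb]

/-- Whether `w` is a sum of weights of items with index below `k`. -/
def Reach (f : ℕ → ℕ) : ℕ → ℕ → Prop
  | 0, w => w = 0
  | k + 1, w => Reach f k w ∨ f k ≤ w ∧ Reach f k (w - f k)

/-- Only this direction is needed here; the converse is made effective by `runs_backtrack`, which
produces the items. -/
theorem reach_of_sum {f : ℕ → ℕ} {k : ℕ} : ∀ {I : Finset ℕ}, I ⊆ range k → Reach f k (∑ i ∈ I, f i) := by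
  induction k with
  | zero => intro I hI; simp_all [Reach]
  | succ k ih =>
    intro I hI
    have hI' : I.erase k ⊆ range k := fun i hi => by
      have := mem_range.1 (hI (mem_of_mem_erase hi))
      have := ne_of_mem_erase hi
      exact mem_range.2 (by omega)
    by_cases hk : k ∈ I
    · right
      rw [← add_sum_erase _ _ hk]
      exact ⟨by omega, by simpa using ih hI'⟩
    · left
      rw [erase_eq_of_notMem hk] at hI'
      exact ih hI'

end Weights

/-! ### The stages of the program -/

namespace WordRAM

open Finset
open scoped Classical

/-- The values of the registers that bound loops: register `4` holds `n ^ 4`, register `0`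
holds `n`. -/
def loopBound (n : ℕ) : ℕ → ℕ := fun x => if x = 4 then n ^ 4 else n

/-- The memory holds the number of vertices and the adjacency matrix of `G`. -/
structure HasGraph {n : ℕ} (G : SimpleGraph (Fin n)) (m : Memory) : Prop where
  reg : m.reg 0 = n
  arr : ∀ u v : Fin n, m.arr 0 (u * n + v) = if G.Adj u v then 1 else 0

section Stages

variable {n : ℕ} {G : SimpleGraph (Fin n)} {m : Memory}

theorem HasGraph.frame (h : HasGraph G m) {R A : List ℕ} {m' : Memory} (hF : Frame R A m m')
    (hR : 0 ∉ R) (hA : 0 ∉ A) : HasGraph G m' :=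
  ⟨(hF.reg 0 hR).trans h.reg, fun u v => by rw [hF.arr 0 hA]; exact h.arr u v⟩

theorem HasGraph.setReg (h : HasGraph G m) {x v : ℕ} (hx : 0 ≠ x) : HasGraph G (m.setReg x v) :=
  ⟨by simp [hx, h.reg], h.arr⟩

theorem HasGraph.setArr (h : HasGraph G m) {a i v : ℕ} (ha : 0 ≠ a) :
    HasGraph G (m.setArr a i v) :=
  ⟨h.reg, fun u w => by simp [ha, h.arr]⟩

theorem le_pow_five (hn : 3 ≤ n) {k : ℕ} (hk : k ≤ n ^ 4) : k < n ^ 5 :=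
  hk.trans_lt (Nat.pow_lt_pow_right (by omega) (by omega))

theorem lt_pow_five (hn : 3 ≤ n) {k : ℕ} (hk : k ≤ n) : k < n ^ 5 :=
  le_pow_five hn (hk.trans (Nat.le_self_pow (by omega) n))

theorem Runs.forVertex {p : Prog} {Q : Memory → Prop} (hn : 3 ≤ n) {x : ℕ}
    (I : ℕ → Memory → Prop) (h : m.reg 0 = n)
    (hx : x ∉ p.regs) (hp : 0 ∉ p.regs) (hx0 : 0 ≠ x) (h0 : I 0 (m.setReg x 0))
    (hs : ∀ i : Fin n, ∀ m', m'.reg x = (i : ℕ) → Frame (x :: p.regs) p.arrs m m' → I i m' →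
      Runs (n ^ 5) (loopBound n) p m' fun m'' => I (i + 1) (m''.setReg x (i + 1)))
    (hQ : ∀ m', Frame (x :: p.regs) p.arrs m m' → I n m' → Q m') :
    Runs (n ^ 5) (loopBound n) (WordRAM.forLoop x 0 p) m Q :=
  Runs.forLoop I (by simp [loopBound, h]) (lt_pow_five hn (by simp [loopBound])) hx hp hx0 h0
    (fun i hi m' => by
      have hi' : i < n := by simpa [loopBound] using hi
      exact hs ⟨i, hi'⟩ m') (fun m' hF hI => hQ m' hF (by simpa [loopBound] using hI))

/-- The first `j` vertices. -/
def below (n j : ℕ) : Finset (Fin n) := univ.filter fun u => (u : ℕ) < j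

theorem mem_below {j : ℕ} {v : Fin n} : v ∈ below n j ↔ (v : ℕ) < j := by simp [below]

theorem below_zero : below n 0 = ∅ := by simp [below]

theorem below_self : below n n = univ := by ext v; simp [below]

theorem below_succ (j : Fin n) : below n (j + 1) = insert j (below n j) := by
  ext v; simp [below, Fin.ext_iff]; omega

theorem degIn_below_succ (v j : Fin n) :
    degIn G (below n (j + 1)) v = degIn G (below n j) v + if G.Adj v j then 1 else 0 := by
  unfold degIn
  rw [below_succ, filter_insert]
  split_ifs with h
  · rw [card_insert_of_notMem (by simp [mem_below])]
  · rfl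

theorem degIn_le (S : Finset (Fin n)) (v : Fin n) : degIn G S v ≤ n :=
  (degIn_le_card G S v).trans (by simpa using card_le_univ S)

/-- Compute the degrees into array `2`. -/
def degrees : Prog :=
  forLoop 6 0 (.seq (.store 2 (.reg 6) 0)
    (forLoop 7 0 (.store 2 (.reg 6) (.arr 2 (.reg 6) + .arr 0 (.reg 6 * .reg 0 + .reg 7)))))

theorem runs_degrees (hn : 3 ≤ n) (h : HasGraph G m) :
    Runs (n ^ 5) (loopBound n) degrees m fun m' => ∀ v : Fin n, m'.arr 2 v = degIn G univ v := by
  refine Runs.forVertex hn (fun i m' => ∀ v : Fin n, (v : ℕ) < i → m'.arr 2 v = degIn G univ v)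
    h.reg (by decide) (by decide) (by decide) (by simp) ?_ (fun m' _ hI v => hI v v.2)
  intro i m₁ hi hF hI
  have h₁ := h.frame hF (by decide) (by decide)
  refine Runs.storeSeq (lt_pow_five hn (by simp)) ?_
  refine Runs.forVertex hn (fun j m' => m'.arr 2 i = degIn G (below n j) i ∧
    ∀ v : Fin n, (v : ℕ) < i → m'.arr 2 v = degIn G univ v) (by simp [h₁.reg])
    (by decide) (by decide) (by decide) ?_ ?_ ?_
  · refine ⟨by simp [hi, below_zero, degIn], fun v hv => ?_⟩
    simp [hi, hI v hv, hv.ne]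
  · rintro j m₂ hj hF₂ ⟨hI₁, hI₂⟩
    have h₂ := (h₁.setArr (by decide)).frame hF₂ (by decide) (by decide)
    have hi₂ : m₂.reg 6 = i := by rw [hF₂.reg 6 (by decide)]; simpa using hi
    have hval : (Exp.arr 2 (.reg 6) + .arr 0 (.reg 6 * .reg 0 + .reg 7)).eval m₂ =
        degIn G (below n (j + 1)) i := by
      simp [hi₂, h₂.reg, hj, h₂.arr, hI₁, degIn_below_succ]
    refine Runs.store (hval ▸ lt_pow_five hn (degIn_le _ _)) ?_
    rw [hval]
    refine ⟨by simp [hi₂], fun v hv => ?_⟩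
    simp [hi₂, hI₂ v hv, hv.ne]
  · rintro m₂ _ ⟨hI₁, hI₂⟩ v hv
    rw [below_self] at hI₁
    rcases Nat.lt_succ_iff_lt_or_eq.1 hv with h | h
    · simpa using hI₂ v h
    · simpa [Fin.ext h] using hI₁

end Stages
end WordRAM

/-! ### The two top vertices, the components of the rest, and their weights. -/

namespace WordRAM

open Finset
open scoped Classical

section Preparation

variable {n : ℕ} {G : SimpleGraph (Fin n)} {m : Memory} {a b : Fin n}

/-- Find two vertices of maximum degree (registers `2` and `3`), and compute `n ^ 4` and
`⌈n / 2⌉` (registers `4` and `5`). -/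
def chooseTop : Prog :=
  .seq (.set 2 0)
  (.seq (forLoop 6 0 (.cond ((Exp.arr 2 (.reg 2)).ltb (.arr 2 (.reg 6))) (.set 2 (.reg 6)) .nop))
  (.seq (.set 3 (1 - .reg 2))
  (.seq (forLoop 6 0 (.cond
    ((1 - (Exp.reg 6).eqb (.reg 2)) * (Exp.arr 2 (.reg 3)).ltb (.arr 2 (.reg 6)))
    (.set 3 (.reg 6)) .nop))
  (.seq (.set 4 (.reg 0 * .reg 0 * .reg 0 * .reg 0)) (.set 5 ((.reg 0 + 1) / 2))))))

theorem runs_chooseTop (hn : 3 ≤ n) (h : m.reg 0 = n) (d : Fin n → ℕ)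
    (hd : ∀ v : Fin n, m.arr 2 v = d v) :
    Runs (n ^ 5) (loopBound n) chooseTop m fun m' => ∃ a b : Fin n, a ≠ b ∧
      (∀ v, d v ≤ d a) ∧ (∀ v, v ≠ a → d v ≤ d b) ∧
      m'.reg 2 = a ∧ m'.reg 3 = b ∧ m'.reg 4 = n ^ 4 ∧ m'.reg 5 = (n + 1) / 2 := by
  refine Runs.setSeq (lt_pow_five hn (by simp)) (Runs.seq
    (Q := fun m' => ∃ a : Fin n, m'.reg 2 = a ∧ ∀ v, d v ≤ d a) ?_ ?_)
  · refine Runs.forVertex hn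
      (fun i m' => ∃ a : Fin n, m'.reg 2 = a ∧ ∀ v : Fin n, (v : ℕ) < i → d v ≤ d a)
      (by simp [h]) (by decide) (by decide) (by decide) ⟨⟨0, by omega⟩, by simp⟩ ?_ ?_
    · rintro i m₁ hi hF ⟨a, ha, hmax⟩
      have hd₁ : ∀ v : Fin n, m₁.arr 2 v = d v := fun v => by
        rw [hF.arr 2 (by decide)]; simp [hd]
      refine Runs.cond (fun hc => ?_) (fun hc => ?_)
      · refine Runs.set (lt_pow_five hn (by simp [hi, i.2.le])) ⟨i, by simp [hi], fun v hv => ?_⟩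
        simp [hi, ha, hd₁] at hc
        rcases Nat.lt_succ_iff_lt_or_eq.1 hv with h | h
        · exact (hmax v h).trans hc.le
        · rw [Fin.ext h]
      · refine Runs.nop ⟨a, by simp [ha], fun v hv => ?_⟩
        simp [hi, ha, hd₁] at hc
        rcases Nat.lt_succ_iff_lt_or_eq.1 hv with h | h
        · exact hmax v h
        · rw [Fin.ext h]; exact hc
    · rintro m₁ - ⟨a, ha, hmax⟩
      exact ⟨a, ha, fun v => hmax v v.2⟩
  rintro m₁ hF ⟨a, ha, hmax⟩
  have hn₁ : m₁.reg 0 = n := by rw [hF.reg 0 (by decide)]; simp [h]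
  have hd₁ : ∀ v : Fin n, m₁.arr 2 v = d v := fun v => by
    rw [hF.arr 2 (by decide)]; simp [hd]
  -- By truncated subtraction, `1 - a` is 1 if `a` is vertex 0 and 0 otherwise, hence a vertex
  -- different from `a`.
  refine Runs.setSeq (lt_pow_five hn (by simp; omega)) (Runs.seq
    (Q := fun m' => ∃ b : Fin n, m'.reg 3 = b ∧ b ≠ a ∧ ∀ v, v ≠ a → d v ≤ d b) ?_ ?_)
  · refine Runs.forVertex hn (fun i m' => ∃ b : Fin n, m'.reg 3 = b ∧ b ≠ a ∧
        ∀ v : Fin n, (v : ℕ) < i → v ≠ a → d v ≤ d b)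
      (by simp [hn₁]) (by decide) (by decide) (by decide)
      ⟨⟨1 - a, by omega⟩, by simp [ha], ?_, by simp⟩ ?_ ?_
    · intro h
      have := congrArg Fin.val h
      simp only at this
      omega
    · rintro i m₂ hi hF₂ ⟨b, hb, hba, hmax'⟩
      have hd₂ : ∀ v : Fin n, m₂.arr 2 v = d v := fun v => by
        rw [hF₂.arr 2 (by decide)]; simp [hd₁]
      have ha₂ : m₂.reg 2 = a := by rw [hF₂.reg 2 (by decide)]; simp [ha]
      refine Runs.cond (fun hc => ?_) (fun hc => ?_)
      · simp [hi, ha₂, hb, hd₂, Fin.val_inj] at hc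
        by_cases hia : i = a
        · simp [hia] at hc
        simp [hia] at hc
        refine Runs.set (lt_pow_five hn (by simp [hi, i.2.le]))
          ⟨i, by simp [hi], hia, fun v hv hva => ?_⟩
        rcases Nat.lt_succ_iff_lt_or_eq.1 hv with h | h
        · exact (hmax' v h hva).trans hc.le
        · rw [Fin.ext h]
      · refine Runs.nop ⟨b, by simp [hb], hba, fun v hv hva => ?_⟩
        rcases Nat.lt_succ_iff_lt_or_eq.1 hv with h | h
        · exact hmax' v h hva
        · rw [Fin.ext h] at hva ⊢
          simpa [hi, ha₂, hb, hd₂, Fin.val_inj, hva] using hc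
    · rintro m₂ - ⟨b, hb, hba, hmax'⟩
      exact ⟨b, hb, hba, fun v => hmax' v v.2⟩
  rintro m₂ hF₂ ⟨b, hb, hba, hmax'⟩
  have hn₂ : m₂.reg 0 = n := by rw [hF₂.reg 0 (by decide)]; simp [hn₁]
  have ha₂ : m₂.reg 2 = a := by rw [hF₂.reg 2 (by decide)]; simp [ha]
  have h4 : n * n * n * n = n ^ 4 := by ring
  refine Runs.setSeq (le_pow_five hn (by simp [hn₂, h4])) (Runs.set (lt_pow_five hn ?_) ?_)
  · simp [hn₂]; omega
  · exact ⟨a, b, hba.symm, hmax, hmax', by simp [ha₂], by simp [hb], by simp [hn₂, h4],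
      by simp [hn₂]⟩

/-- Whether a vertex differs from the two in registers `2` and `3`. -/
def other (e : Exp) : Exp := (1 - e.eqb (.reg 2)) * (1 - e.eqb (.reg 3))

theorem eval_other (ha : m.reg 2 = a) (hb : m.reg 3 = b) {e : Exp} {v : Fin n}
    (he : e.eval m = v) : (other e).eval m = if v ≠ a ∧ v ≠ b then 1 else 0 := by
  simp only [other, Exp.eval_mul, Exp.eval_sub, Exp.eval_one, Exp.eval_eqb, he, Exp.eval_reg, ha,
    hb, Fin.val_inj]
  by_cases h1 : v = a <;> by_cases h2 : v = b <;> simp [h1, h2]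

/-- Replace the value in register `9` by the value in register `8` throughout array `3`. -/
def relabel : Prog :=
  forLoop 10 0 (.cond ((Exp.arr 3 (.reg 10)).eqb (.reg 9)) (.store 3 (.reg 10) (.reg 8)) .nop)

theorem runs_relabel (hn : 3 ≤ n) (h : m.reg 0 = n) (h8 : m.reg 8 < n) :
    Runs (n ^ 5) (loopBound n) relabel m fun m' => ∀ v : Fin n,
      m'.arr 3 v = if m.arr 3 v = m.reg 9 then m.reg 8 else m.arr 3 v := by
  refine Runs.forVertex hn (fun i m' => ∀ v : Fin n,
      m'.arr 3 v = if (v : ℕ) < i ∧ m.arr 3 v = m.reg 9 then m.reg 8 else m.arr 3 v)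
      h (by decide) (by decide) (by decide) (by simp) ?_ ?_
  · intro i m₁ hi hF hI
    have e8 := hF.reg 8 (by decide)
    have e9 := hF.reg 9 (by decide)
    refine Runs.cond (fun hc => ?_) (fun hc => ?_)
    · simp [hi, e9, hI] at hc
      refine Runs.store (lt_pow_five hn (by simp [e8, h8.le])) fun v => ?_
      by_cases hv : v = i
      · simp [hv, hi, e8, hc]
      · have h1 : (v : ℕ) ≠ i := fun h => hv (Fin.ext h)
        have h2 : (v : ℕ) < i + 1 ↔ (v : ℕ) < i := by omega
        simp [hi, h1, h2, hI]
    · simp [hi, e9, hI] at hc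
      refine Runs.nop fun v => ?_
      by_cases hv : v = i
      · simp [hv, hc, hI]
      · have h1 : (v : ℕ) ≠ i := fun h => hv (Fin.ext h)
        have h2 : (v : ℕ) < i + 1 ↔ (v : ℕ) < i := by omega
        simp [h2, hI]
  · intro m₁ _ hI v
    simp [hI]

/-- Label the pieces in array `3`. -/
def labels : Prog :=
  .seq (forLoop 6 0 (.store 3 (.reg 6) (.reg 6)))
  (forLoop 6 0 (forLoop 7 0 (.cond
    (.arr 0 (.reg 6 * .reg 0 + .reg 7) * (other (.reg 6) * other (.reg 7)))
    (.seq (.set 8 (.arr 3 (.reg 6))) (.seq (.set 9 (.arr 3 (.reg 7))) relabel)) .nop)))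

/-- The array `3` holds a partial labelling, taking account of the edges in `D`. -/
def PartialLabels (G : SimpleGraph (Fin n)) (a b : Fin n) (D : Fin n → Fin n → Prop) (m : Memory) :
    Prop :=
  (∀ v : Fin n, m.arr 3 v < n) ∧
  (∀ X, LocClosed G a b X → ∀ u v : Fin n, m.arr 3 u = m.arr 3 v → u ∈ X → v ∈ X) ∧
  ∀ u v, D u v → G.Adj u v → u ≠ a → u ≠ b → v ≠ a → v ≠ b → m.arr 3 u = m.arr 3 v

/-- The edge xy avoids `a` and `b`, so a set closed in G - {a, b} contains both ends or neither;
merging the two classes therefore preserves the separation property. -/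
theorem PartialLabels.relabel {D : Fin n → Fin n → Prop} (h : PartialLabels G a b D m)
    {m' : Memory} {x y : Fin n} (hxy : G.Adj x y) (hxa : x ≠ a) (hxb : x ≠ b) (hya : y ≠ a)
    (hyb : y ≠ b)
    (hm : ∀ v : Fin n, m'.arr 3 v = if m.arr 3 v = m.arr 3 y then m.arr 3 x else m.arr 3 v)
    {D' : Fin n → Fin n → Prop} (hD : ∀ u v, D' u v → D u v ∨ u = x ∧ v = y) :
    PartialLabels G a b D' m' := by
  obtain ⟨h1, h2, h3⟩ := h
  refine ⟨fun v => ?_, fun X hX u v huv hu => ?_, fun u v huv hadj hua hub hva hvb => ?_⟩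
  · rw [hm]; split_ifs
    · exact h1 x
    · exact h1 v
  · rw [hm, hm] at huv
    split_ifs at huv with hu' hv' hv'
    · exact h2 X hX u v (hu'.trans hv'.symm) hu
    · have hy := h2 X hX u y hu' hu
      exact h2 X hX x v huv (hX y hy x hxy.symm hya hyb hxa hxb)
    · have hx := h2 X hX u x huv hu
      exact h2 X hX y v hv'.symm (hX x hx y hxy hxa hxb hya hyb)
    · exact h2 X hX u v huv hu
  · rw [hm, hm]
    rcases hD u v huv with h | ⟨rfl, rfl⟩
    · rw [h3 u v h hadj hua hub hva hvb]
    · simp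

theorem runs_labels (hn : 3 ≤ n) (h : HasGraph G m) (ha : m.reg 2 = a) (hb : m.reg 3 = b) :
    Runs (n ^ 5) (loopBound n) labels m fun m' =>
      IsLabelling G a b fun v : Fin n => m'.arr 3 v := by
  refine Runs.seq (Q := fun m' => PartialLabels G a b (fun u _ => (u : ℕ) < 0) m') ?_ ?_
  · refine Runs.forVertex hn (fun i m' => ∀ v : Fin n, (v : ℕ) < i → m'.arr 3 v = v)
      h.reg (by decide) (by decide) (by decide) (by simp) ?_ ?_
    · intro i m₁ hi hF hI
      refine Runs.store (lt_pow_five hn (by simp [hi, i.2.le])) fun v hv => ?_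
      by_cases hv' : (v : ℕ) = i
      · simp [hv', hi]
      · simp [hi, hv', hI v (by omega)]
    · intro m₁ hF hI
      refine ⟨fun v => by rw [hI v v.2]; exact v.2, fun X _ u v huv hu => ?_, by simp⟩
      rw [hI u u.2, hI v v.2] at huv
      exact Fin.ext huv ▸ hu
  intro m₁ hF₁ hI₁
  refine Runs.forVertex hn (fun i m' => PartialLabels G a b (fun u _ => (u : ℕ) < i) m')
    (by rw [hF₁.reg 0 (by decide), h.reg]) (by decide) (by decide) (by decide) hI₁ ?_ ?_
  · intro i m₂ hi hF₂ hI₂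
    have hF₂' := (hF₁.mono (R' := (labels).regs) (A' := labels.arrs) (by decide) (by decide)).trans
      (hF₂.mono (by decide) (by decide))
    -- The processed pairs form a lexicographic initial segment.
    refine Runs.forVertex hn (fun j m' => PartialLabels G a b
      (fun u v => (u : ℕ) < i ∨ u = i ∧ (v : ℕ) < j) m')
      (by rw [hF₂'.reg 0 (by decide), h.reg]) (by decide) (by decide) (by decide)
      (by simpa [PartialLabels] using hI₂) ?_ ?_
    · intro j m₃ hj hF₃ hI₃
      have hF₃' := hF₂'.trans (hF₃.mono (by decide) (by decide))
      have h₃ := h.frame hF₃' (by decide) (by decide)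
      have hi₃ : m₃.reg 6 = i := (hF₃.reg 6 (by decide)).trans hi
      have ha₃ : m₃.reg 2 = a := (hF₃'.reg 2 (by decide)).trans ha
      have hb₃ : m₃.reg 3 = b := (hF₃'.reg 3 (by decide)).trans hb
      have hval : (Exp.arr 0 (.reg 6 * .reg 0 + .reg 7) * (other (.reg 6) * other (.reg 7))).eval m₃
          = if G.Adj i j ∧ (i ≠ a ∧ i ≠ b) ∧ j ≠ a ∧ j ≠ b then 1 else 0 := by
        rw [Exp.eval_mul, Exp.eval_mul, eval_other ha₃ hb₃ (v := i) (by simp [hi₃]),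
          eval_other ha₃ hb₃ (v := j) (by simp [hj])]
        simp only [Exp.eval_arr, Exp.eval_add, Exp.eval_mul, Exp.eval_reg, hi₃, hj, h₃.reg, h₃.arr]
        simp only [ite_and, mul_ite, mul_one, mul_zero]
        split_ifs <;> rfl
      have hD : ∀ u v : Fin n, ((u : ℕ) < i ∨ u = i ∧ (v : ℕ) < j + 1) →
          ((u : ℕ) < i ∨ u = i ∧ (v : ℕ) < j) ∨ u = i ∧ v = j := by
        intro u v huv
        rw [Fin.ext_iff (a := v)]
        omega
      refine Runs.cond (fun hc => ?_) (fun hc => ?_)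
      · rw [hval, ne_eq, ite_eq_right_iff, Classical.not_imp] at hc
        obtain ⟨⟨hadj, ⟨hia, hib⟩, hja, hjb⟩, -⟩ := hc
        refine Runs.setSeq (lt_pow_five hn (by simp [hi₃, (hI₃.1 i).le]))
          (Runs.setSeq (lt_pow_five hn (by simp [hj, (hI₃.1 j).le]))
          ((runs_relabel hn (by simp [h₃.reg]) (by simp [hi₃, hI₃.1 i])).mono
          fun m₄ _ hm₄ => ?_))
        refine hI₃.relabel (x := i) (y := j) hadj hia hib hja hjb (fun v => ?_) hD
        simp [hm₄ v, hi₃, hj]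
      · rw [hval] at hc
        refine Runs.nop ⟨hI₃.1, hI₃.2.1, fun u v huv hadj hua hub hva hvb => ?_⟩
        rcases hD u v huv with h | ⟨rfl, rfl⟩
        · exact hI₃.2.2 u v h hadj hua hub hva hvb
        · simp [hadj, hua, hub, hva, hvb] at hc
    · intro m₃ _ hI₃
      refine ⟨hI₃.1, hI₃.2.1, fun u v huv => hI₃.2.2 u v ?_⟩
      rcases Nat.lt_succ_iff_lt_or_eq.1 huv with h | h
      · exact Or.inl h
      · exact Or.inr ⟨Fin.ext h, v.2⟩
  · intro m₂ _ hI₂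
    exact ⟨hI₂.1, fun u v hadj hua hub hva hvb => hI₂.2.2 u v u.2 hadj hua hub hva hvb, hI₂.2.1⟩

/-- Compute the weights of the pieces into array `4`. -/
def weights : Prog :=
  .seq (forLoop 6 0 (.store 4 (.reg 6) 0))
  (forLoop 6 0 (.cond (other (.reg 6))
    (.store 4 (.arr 3 (.reg 6)) (.arr 4 (.arr 3 (.reg 6)) +
      (1 + .reg 0 * .arr 0 (.reg 2 * .reg 0 + .reg 6) +
        .reg 0 * .reg 0 * .arr 0 (.reg 3 * .reg 0 + .reg 6)))) .nop))

/-- Ensures that piece weights and their partial sums fit in a word. -/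
theorem sum_vertexWeight_le (hn : 3 ≤ n) (S : Finset (Fin n)) :
    ∑ v ∈ S, vertexWeight G a b v ≤ n ^ 4 := by
  rw [sum_vertexWeight]
  have h1 := degIn_le (G := G) S a
  have h2 := degIn_le (G := G) S b
  have h3 : S.card ≤ n := by simpa using card_le_univ S
  calc _ ≤ n + n * n + n ^ 2 * n := by gcongr
    _ ≤ n ^ 4 := by nlinarith [Nat.pow_le_pow_left hn 2, Nat.pow_le_pow_left hn 3, sq n, pow_succ n 2, pow_succ n 3]

theorem runs_weights (hn : 3 ≤ n) (h : HasGraph G m) (ha : m.reg 2 = a) (hb : m.reg 3 = b)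
    (lab : Fin n → ℕ) (hl : ∀ v : Fin n, m.arr 3 v = lab v) (hlt : ∀ v, lab v < n) :
    Runs (n ^ 5) (loopBound n) weights m fun m' =>
      ∀ k < n, m'.arr 4 k = pieceWeight G a b lab k := by
  refine Runs.seq (Q := fun m' => ∀ k < n, m'.arr 4 k = 0) ?_ ?_
  · refine Runs.forVertex hn (fun i m' => ∀ k < i, m'.arr 4 k = 0)
      h.reg (by decide) (by decide) (by decide) (by simp) ?_ ?_
    · intro i m₁ hi hF hI
      refine Runs.store (lt_pow_five hn (by simp)) fun v hv => ?_
      by_cases hv' : v = i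
      · simp [hv', hi]
      · simp [hi, hv', hI v (by omega)]
    · exact fun _ _ hI => hI
  intro m₁ hF₁ hI₁
  refine Runs.forVertex hn (fun i m' => ∀ k < n, m'.arr 4 k =
      ∑ v ∈ (below n i).filter fun v => v ≠ a ∧ v ≠ b ∧ lab v = k, vertexWeight G a b v)
    (by rw [hF₁.reg 0 (by decide), h.reg]) (by decide) (by decide) (by decide)
    (by simpa [below_zero] using hI₁) ?_ ?_
  · intro i m₂ hi hF₂ hI₂
    have hF₂' := (hF₁.mono (R' := weights.regs) (A' := weights.arrs) (by decide) (by decide)).trans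
      (hF₂.mono (by decide) (by decide))
    have h₂ := h.frame hF₂' (by decide) (by decide)
    have ha₂ : m₂.reg 2 = a := (hF₂'.reg 2 (by decide)).trans ha
    have hb₂ : m₂.reg 3 = b := (hF₂'.reg 3 (by decide)).trans hb
    have hl₂ : m₂.arr 3 i = lab i := by rw [hF₂'.arr 3 (by decide), hl]
    have hval := eval_other ha₂ hb₂ (e := .reg 6) (v := i) (by simp [hi])
    refine Runs.cond (fun hc => ?_) (fun hc => ?_)
    · rw [hval, ne_eq, ite_eq_right_iff, Classical.not_imp] at hc
      have hstep : ∀ k < n, ∑ v ∈ (below n (i + 1)).filter (fun v => v ≠ a ∧ v ≠ b ∧ lab v = k),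
          vertexWeight G a b v = m₂.arr 4 k + if k = lab i then vertexWeight G a b i else 0 := by
        intro k hk
        rw [below_succ, filter_insert, hI₂ k hk]
        by_cases hki : k = lab i
        · rw [if_pos ⟨hc.1.1, hc.1.2, hki.symm⟩, if_pos hki, sum_insert (by simp [mem_below]),
            add_comm]
        · rw [if_neg (fun hh => hki hh.2.2.symm), if_neg hki, add_zero]
      have hnew : (Exp.arr 4 (.arr 3 (.reg 6)) +
          (1 + .reg 0 * .arr 0 (.reg 2 * .reg 0 + .reg 6) +
          .reg 0 * .reg 0 * .arr 0 (.reg 3 * .reg 0 + .reg 6))).eval m₂ =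
          ∑ v ∈ (below n (i + 1)).filter (fun v => v ≠ a ∧ v ≠ b ∧ lab v = lab i),
            vertexWeight G a b v := by
        rw [hstep _ (hlt i)]
        simp [hi, hl₂, h₂.reg, h₂.arr, ha₂, hb₂, vertexWeight, sq]
      refine Runs.store (hnew ▸ le_pow_five hn (sum_vertexWeight_le hn _)) fun k hk => ?_
      rw [hnew, hstep _ (hlt i), hstep k hk]
      by_cases hki : k = lab i
      · simp [hki, hi, hl₂]
      · simp [hki, hi, hl₂]
    · rw [hval] at hc
      refine Runs.nop fun k hk => ?_
      rw [below_succ, filter_insert, if_neg]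
      · exact hI₂ k hk
      · intro hh; simp [hh.1, hh.2.1] at hc
  · intro m₂ _ hI₂ k hk
    rw [hI₂ k hk, below_self, pieceWeight, piece]

end Preparation
end WordRAM

/-! ### The subset-sum table and the search for the best good weight. -/

namespace WordRAM

open Finset
open scoped Classical

section Selection

variable {n : ℕ} {G : SimpleGraph (Fin n)} {m : Memory} {a b : Fin n} {lab : Fin n → ℕ}
  {conn fa fb : Bool}

/-- The memory after the preparatory stages. -/
structure Prepared (G : SimpleGraph (Fin n)) (a b : Fin n) (lab : Fin n → ℕ) (m : Memory) :
    Prop where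
  graph : HasGraph G m
  top₁ : m.reg 2 = a
  top₂ : m.reg 3 = b
  bound : m.reg 4 = n ^ 4
  half : m.reg 5 = (n + 1) / 2
  deg : ∀ v : Fin n, m.arr 2 v = degIn G univ v
  label : ∀ v : Fin n, m.arr 3 v = lab v
  weight : ∀ k < n, m.arr 4 k = pieceWeight G a b lab k

theorem Prepared.frame (h : Prepared G a b lab m) {R A : List ℕ} {m' : Memory}
    (hF : Frame R A m m') (hR : ∀ x ∈ [0, 2, 3, 4, 5], x ∉ R) (hA : ∀ x ∈ [0, 2, 3, 4], x ∉ A) :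
    Prepared G a b lab m' where
  graph := h.graph.frame hF (hR _ (by simp)) (hA _ (by simp))
  top₁ := (hF.reg 2 (hR _ (by simp))).trans h.top₁
  top₂ := (hF.reg 3 (hR _ (by simp))).trans h.top₂
  bound := (hF.reg 4 (hR _ (by simp))).trans h.bound
  half := (hF.reg 5 (hR _ (by simp))).trans h.half
  deg v := by rw [hF.arr 2 (hA _ (by simp)), h.deg]
  label v := by rw [hF.arr 3 (hA _ (by simp)), h.label]
  weight k hk := by rw [hF.arr 4 (hA _ (by simp)), h.weight k hk]

/-- The weights of the items, computed into array `5`. -/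
def itemExp (conn fa fb : Bool) : Exp :=
  if conn then
    if fa || fb then
      (1 - (Exp.arr 4 (.reg 6)).ltb (.reg 0)) * (.arr 4 (.reg 6) + .reg 0 * .reg 0 * .reg 0 *
        ((0 : Exp).ltb (.arr 4 (.reg 6) / .reg 0 % .reg 0) *
          (0 : Exp).ltb (.arr 4 (.reg 6) / (.reg 0 * .reg 0))))
    else .arr 4 (.reg 6) + .reg 0 * .reg 0 * .reg 0 * (0 : Exp).ltb (.arr 4 (.reg 6))
  else .arr 4 (.reg 6)

theorem eval_itemExp (conn fa fb : Bool) (m : Memory) : (itemExp conn fa fb).eval m =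
    itemWeight conn fa fb (m.reg 0) (m.arr 4 (m.reg 6)) := by
  have h3 : m.reg 0 * m.reg 0 * m.reg 0 = m.reg 0 ^ 3 := by ring
  cases conn <;> [skip; cases hf : (fa || fb)] <;> simp only [itemExp, itemWeight, bonus]
  · simp
  · by_cases h : 0 < m.arr 4 (m.reg 6) <;> simp [hf, h, h3]
  · simp only [hf, if_true, Exp.eval_mul, Exp.eval_add, Exp.eval_sub, Exp.eval_one, Exp.eval_ltb,
      Exp.eval_arr, Exp.eval_reg, Exp.eval_zero, Exp.eval_div, Exp.eval_mod, ← sq, ← pow_succ]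
    by_cases h : m.arr 4 (m.reg 6) < m.reg 0 <;>
      by_cases hx : 0 < m.arr 4 (m.reg 6) / m.reg 0 % m.reg 0 <;>
      by_cases hy : 0 < m.arr 4 (m.reg 6) / m.reg 0 ^ 2 <;>
      simp only [h, hx, hy] <;> simp

/-- Compute the weights of the items into array `5`. -/
def items (conn fa fb : Bool) : Prog := forLoop 6 0 (.store 5 (.reg 6) (itemExp conn fa fb))

theorem itemWeight_lt (hn : 3 ≤ n) {w : ℕ} (hw : w ≤ n ^ 4) :
    itemWeight conn fa fb n w < n ^ 5 := by
  have h1 := bonus_le_one conn fa fb n w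
  have h2 : itemWeight conn fa fb n w ≤ w + n ^ 3 * bonus conn fa fb n w := by
    unfold itemWeight; split_ifs <;> simp
  have h3 : n ^ 3 * bonus conn fa fb n w ≤ n ^ 3 := by nlinarith [Nat.zero_le (n ^ 3)]
  have h4 : n ^ 3 ≤ n ^ 4 := Nat.pow_le_pow_right (by omega) (by omega)
  have h5 : 0 < n ^ 4 := by positivity
  have h6 : n ^ 5 = n ^ 4 * n := pow_succ n 4
  nlinarith

theorem runs_items (hn : 3 ≤ n) (h : Prepared G a b lab m) :
    Runs (n ^ 5) (loopBound n) (items conn fa fb) m fun m' =>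
      ∀ k < n, m'.arr 5 k = itemWeight conn fa fb n (pieceWeight G a b lab k) := by
  refine Runs.forVertex hn (fun i m' => ∀ k < i, m'.arr 5 k =
      itemWeight conn fa fb n (pieceWeight G a b lab k)) h.graph.reg
    (by simp [Prog.regs]) (by simp [Prog.regs]) (by decide) (by simp) ?_ (fun _ _ hI => hI)
  intro i m₁ hi hF hI
  have h₁ := h.frame hF (by simp [Prog.regs]) (by simp [Prog.arrs])
  have hval : (itemExp conn fa fb).eval m₁ =
      itemWeight conn fa fb n (pieceWeight G a b lab i) := by
    rw [eval_itemExp, h₁.graph.reg, hi, h₁.weight i i.2]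
  refine Runs.store (hval ▸ itemWeight_lt hn (sum_vertexWeight_le hn _)) fun k hk => ?_
  rw [hval]
  by_cases hki : k = i
  · simp [hki, hi]
  · simp [hki, hi, hI k (by omega)]

/-- Compute into row `k` of the table in array `6` which weights are reachable with the first
`k` items. -/
def table : Prog :=
  .seq (forLoop 6 4 (.store 6 (.reg 6) ((Exp.reg 6).eqb 0)))
  (forLoop 6 0 (forLoop 7 4 (.store 6 ((.reg 6 + 1) * .reg 4 + .reg 7)
    ((0 : Exp).ltb (.arr 6 (.reg 6 * .reg 4 + .reg 7) + (1 - (Exp.reg 7).ltb (.arr 5 (.reg 6))) *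
      .arr 6 (.reg 6 * .reg 4 + .reg 7 - .arr 5 (.reg 6)))))))

theorem bit_lt (hn : 3 ≤ n) (p : Prop) [Decidable p] : (if p then 1 else 0) < n ^ 5 :=
  lt_pow_five hn (by split_ifs <;> omega)

theorem bit_ne_zero {p : Prop} [Decidable p] : ¬ (if p then 1 else 0) = 0 ↔ p := by
  split_ifs <;> simp [*]

/-- Writing row `i + 1` of the table disturbs no earlier row. -/
theorem row_ne {N k i w j : ℕ} (hk : k ≤ i) (hw : w < N) : k * N + w ≠ (i + 1) * N + j := by
  have : (k + 1) * N ≤ (i + 1) * N := Nat.mul_le_mul_right _ (by omega)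
  have h2 : (k + 1) * N = k * N + N := by ring
  omega

/-- This stage costs n · n^4. Addresses in the last row reach n^5 and beyond, which is harmless:
they occur only inside expressions, and the word bound applies to written values. -/
theorem runs_table (hn : 3 ≤ n) (h0 : m.reg 0 = n) (h4 : m.reg 4 = n ^ 4) (f : ℕ → ℕ)
    (hf : ∀ k < n, m.arr 5 k = f k) :
    Runs (n ^ 5) (loopBound n) table m fun m' => ∀ k ≤ n, ∀ w < n ^ 4,
      m'.arr 6 (k * n ^ 4 + w) = if Reach f k w then 1 else 0 := by
  have hb : loopBound n 4 = n ^ 4 := rfl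
  have hb5 : loopBound n 4 < n ^ 5 := le_pow_five hn le_rfl
  refine Runs.seq (Q := fun m' => ∀ k ≤ 0, ∀ w < n ^ 4,
    m'.arr 6 (k * n ^ 4 + w) = if Reach f k w then 1 else 0) ?_ ?_
  · refine Runs.forLoop (fun i m' => ∀ w < i, m'.arr 6 w = if w = 0 then 1 else 0)
      (h4.trans hb.symm) hb5 (by decide) (by decide) (by decide) (by simp) ?_ ?_
    · intro i hi m₁ hi' hF hI
      refine Runs.store (by rw [Exp.eval_eqb]; exact bit_lt hn _) fun w hw => ?_
      by_cases hwi : w = i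
      · simp [hwi, hi']
      · simp [hwi, hi', hI w (by omega)]
    · intro m₁ _ hI k hk w hw
      obtain rfl : k = 0 := by omega
      rw [zero_mul, zero_add, hI w hw]
      by_cases hw0 : w = 0 <;> simp [Reach, hw0]
  intro m₁ hF₁ hI₁
  refine Runs.forVertex hn (fun i m' => ∀ k ≤ i, ∀ w < n ^ 4,
      m'.arr 6 (k * n ^ 4 + w) = if Reach f k w then 1 else 0)
    (by rw [hF₁.reg 0 (by decide), h0]) (by decide) (by decide) (by decide) hI₁ ?_
    (fun m' _ hI => hI)
  intro i m₂ hi hF₂ hI₂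
  have hF₂' := (hF₁.mono (R' := table.regs) (A' := table.arrs) (by decide) (by decide)).trans
    (hF₂.mono (by decide) (by decide))
  have h4₂ : m₂.reg 4 = n ^ 4 := (hF₂'.reg 4 (by decide)).trans h4
  refine Runs.forLoop (fun j m' => (∀ k ≤ (i : ℕ), ∀ w < n ^ 4,
      m'.arr 6 (k * n ^ 4 + w) = if Reach f k w then 1 else 0) ∧ ∀ w < j,
      m'.arr 6 ((i + 1) * n ^ 4 + w) = if Reach f (i + 1) w then 1 else 0)
    (h4₂.trans hb.symm) hb5 (by decide) (by decide) (by decide) ⟨by simpa using hI₂, by simp⟩ ?_ ?_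
  · rintro j hj m₃ hj' hF₃ ⟨hI₃, hI₃'⟩
    rw [hb] at hj
    have hi₃ : m₃.reg 6 = i := (hF₃.reg 6 (by decide)).trans hi
    have h4₃ : m₃.reg 4 = n ^ 4 := (hF₃.reg 4 (by decide)).trans h4₂
    have hf₃ : m₃.arr 5 i = f i := by
      rw [hF₃.arr 5 (by decide), hF₂'.arr 5 (by decide), hf i i.2]
    have hval : ((0 : Exp).ltb (.arr 6 (.reg 6 * .reg 4 + .reg 7) +
        (1 - (Exp.reg 7).ltb (.arr 5 (.reg 6))) *
          .arr 6 (.reg 6 * .reg 4 + .reg 7 - .arr 5 (.reg 6)))).eval m₃ =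
        if Reach f (i + 1) j then 1 else 0 := by
      simp only [Exp.eval_ltb, Exp.eval_add, Exp.eval_arr, Exp.eval_mul, Exp.eval_sub,
        Exp.eval_reg, Exp.eval_zero, Exp.eval_one, hi₃, h4₃, hj', hf₃, hI₃ i le_rfl j hj]
      -- If `j < f i`, the subtracted address does not stand for a valid smaller weight; the value
      -- read there is masked by a factor 0.
      by_cases hlt : j < f i
      · have : Reach f (i + 1) j ↔ Reach f i j := by simp [Reach]; omega
        simp only [hlt, this]
        split_ifs <;> simp_all
      · have : Reach f (i + 1) j ↔ Reach f i j ∨ Reach f i (j - f i) := by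
          simp only [Reach, not_lt.1 hlt, true_and]
        rw [Nat.add_sub_assoc (not_lt.1 hlt), hI₃ i le_rfl _ (by omega)]
        simp only [hlt, this]
        by_cases h1 : Reach f i j <;> by_cases h2 : Reach f i (j - f i) <;> simp [h1, h2]
    refine Runs.store (hval ▸ bit_lt hn _) ?_
    rw [hval]
    refine ⟨fun k hk w hw => ?_, fun w hw => ?_⟩
    · simp only [Memory.setReg_arr, Memory.setArr_arr_apply, Exp.eval_add, Exp.eval_mul,
        Exp.eval_reg, Exp.eval_one, hi₃, h4₃, hj', row_ne hk hw, and_false, if_false]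
      exact hI₃ k hk w hw
    · simp only [Memory.setReg_arr, Memory.setArr_arr_apply, Exp.eval_add, Exp.eval_mul,
        Exp.eval_reg, Exp.eval_one, hi₃, h4₃, hj', true_and, Nat.add_left_cancel_iff]
      by_cases hwj : w = j
      · simp [hwj]
      · simp [hwj, hI₃' w (by omega)]
  · rintro m₃ - ⟨hI₃, hI₃'⟩ k hk w hw
    rcases Nat.lt_succ_iff_lt_or_eq.1 (Nat.lt_succ_of_le hk) with h | rfl
    · exact hI₃ k (by omega) w hw
    · exact hI₃' w hw

/-- The size of the selection of weight given by register `6`. -/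
def sizeExp (fa fb : Bool) : Exp := .const fa.toNat + .const fb.toNat + .reg 6 % .reg 0

/-- The test whether the weight in register `6` is good. -/
def goodExp (conn fa fb : Bool) : Exp :=
  (1 : Exp).ltb (sizeExp fa fb) * (sizeExp fa fb).ltb (.reg 0) *
  (if fa then 1 - ((Exp.reg 6 / .reg 0 % .reg 0 + .arr 0 (.reg 2 * .reg 0 + .reg 3) *
      .const fb.toNat) * (.reg 0 - 1) : Exp).ltb (.arr 2 (.reg 2) * (sizeExp fa fb - 1))
    else (Exp.reg 6 / .reg 0 % .reg 0).eqb 0) *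
  (if fb then 1 - ((Exp.reg 6 / (.reg 0 * .reg 0) % .reg 0 + .arr 0 (.reg 2 * .reg 0 + .reg 3) *
      .const fa.toNat) * (.reg 0 - 1) : Exp).ltb (.arr 2 (.reg 3) * (sizeExp fa fb - 1))
    else (.reg 6 / (.reg 0 * .reg 0) % .reg 0 : Exp).eqb 0) *
  (if conn then
    if fa && fb then
      (0 : Exp).ltb (.arr 0 (.reg 2 * .reg 0 + .reg 3) + .reg 6 / (.reg 0 * .reg 0 * .reg 0))
    else if fa || fb then 1 else (.reg 6 / (.reg 0 * .reg 0 * .reg 0) : Exp).eqb 1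
  else 1)

theorem eval_goodExp (h : Prepared G a b lab m) : (goodExp conn fa fb).eval m ≠ 0 ↔
    Good conn fa fb n (if G.Adj a b then 1 else 0) (degIn G univ a) (degIn G univ b)
      (m.reg 6) := by
  have h3 : n * n * n = n ^ 3 := by ring
  have hite : ∀ {p : Prop} [Decidable p], (1 - if p then 1 else 0) = 0 ↔ p := by
    intro p _; split_ifs <;> simp [*]
  unfold Good goodExp sizeExp
  simp only [Exp.eval_mul, ne_eq, mul_eq_zero, not_or, and_assoc]
  refine and_congr ?_ (and_congr ?_ (and_congr ?_ (and_congr ?_ ?_)))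
  · simp [h.graph.reg, Nat.succ_le_iff]
  · simp [h.graph.reg]
  · cases fa <;> simp [h.graph.reg, h.top₁, h.top₂, h.graph.arr, h.deg, hite]
  · cases fb <;> simp [h.graph.reg, h.top₁, h.top₂, h.graph.arr, h.deg, hite, ← sq]
  · by_cases hadj : G.Adj a b <;> cases conn <;> cases fa <;> cases fb <;>
      simp [hadj, h.graph.reg, h.top₁, h.top₂, h.graph.arr, h3]

/-- Find a reachable good weight whose size exceeds the best size so far (register `1`) and is as
large as possible; register `11` receives its successor, or `0` if there is none. -/
def search (conn fa fb : Bool) : Prog :=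
  .seq (.set 11 0) (forLoop 6 4 (.cond
    (.arr 6 (.reg 0 * .reg 4 + .reg 6) * goodExp conn fa fb * (Exp.reg 1).ltb (sizeExp fa fb))
    (.seq (.set 1 (sizeExp fa fb)) (.set 11 (.reg 6 + 1))) .nop))

theorem runs_search (hn : 3 ≤ n) (h : Prepared G a b lab m) (f : ℕ → ℕ)
    (hf : ∀ w < n ^ 4, m.arr 6 (n * n ^ 4 + w) = if Reach f n w then 1 else 0) :
    Runs (n ^ 5) (loopBound n) (search conn fa fb) m fun m' =>
      (m'.reg 11 = 0 ∧ m'.reg 1 = m.reg 1 ∨ ∃ w < n ^ 4, m'.reg 11 = w + 1 ∧ Reach f n w ∧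
        Good conn fa fb n (if G.Adj a b then 1 else 0) (degIn G univ a) (degIn G univ b) w ∧
        m'.reg 1 = fa.toNat + fb.toNat + w % n ∧ m.reg 1 < m'.reg 1) ∧
      ∀ w < n ^ 4, Reach f n w →
        Good conn fa fb n (if G.Adj a b then 1 else 0) (degIn G univ a) (degIn G univ b) w →
        fa.toNat + fb.toNat + w % n ≤ m'.reg 1 := by
  refine Runs.setSeq (lt_pow_five hn (by simp)) (Runs.forLoop (fun i m' =>
      (m'.reg 11 = 0 ∧ m'.reg 1 = m.reg 1 ∨ ∃ w < n ^ 4, m'.reg 11 = w + 1 ∧ Reach f n w ∧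
        Good conn fa fb n (if G.Adj a b then 1 else 0) (degIn G univ a) (degIn G univ b) w ∧
        m'.reg 1 = fa.toNat + fb.toNat + w % n ∧ m.reg 1 < m'.reg 1) ∧
      ∀ w < i, Reach f n w →
        Good conn fa fb n (if G.Adj a b then 1 else 0) (degIn G univ a) (degIn G univ b) w →
        fa.toNat + fb.toNat + w % n ≤ m'.reg 1)
    (by simp [h.bound, loopBound]) (le_pow_five hn le_rfl) (by simp [Prog.regs])
    (by simp [Prog.regs]) (by decide) ⟨by simp, by simp⟩ ?_ (fun m' _ hI => hI))
  rintro i hi m₁ hi' hF ⟨hI, hI'⟩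
  have hi : i < n ^ 4 := hi
  have h₁ : Prepared G a b lab m₁ := (h.frame (m' := m.setReg 11 0) (R := [11]) (A := [])
    ⟨fun x hx => by simp at hx; simp [hx], fun _ _ => rfl⟩ (by decide) (by decide)).frame hF
      (by simp [Prog.regs]) (by simp [Prog.arrs])
  have hf₁ : m₁.arr 6 (n * n ^ 4 + i) = if Reach f n i then 1 else 0 := by
    rw [hF.arr 6 (by simp [Prog.arrs])]; exact hf i hi
  have hsize : (sizeExp fa fb).eval m₁ = fa.toNat + fb.toNat + i % n := by
    simp [sizeExp, h₁.graph.reg, hi']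
  have hgood := eval_goodExp (conn := conn) (fa := fa) (fb := fb) h₁
  rw [hi'] at hgood
  have hcond : (Exp.arr 6 (.reg 0 * .reg 4 + .reg 6) * goodExp conn fa fb *
      (Exp.reg 1).ltb (sizeExp fa fb)).eval m₁ ≠ 0 ↔ (Reach f n i ∧
        Good conn fa fb n (if G.Adj a b then 1 else 0) (degIn G univ a) (degIn G univ b) i) ∧
        m₁.reg 1 < fa.toNat + fb.toNat + i % n := by
    rw [← hgood, ← hsize]
    simp only [Exp.eval_mul, ne_eq, mul_eq_zero, not_or, Exp.eval_ltb, bit_ne_zero, Exp.eval_arr,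
      Exp.eval_add, Exp.eval_reg, h₁.graph.reg, h₁.bound, hi', hf₁]
    exact and_congr Iff.rfl bit_ne_zero
  refine Runs.cond (fun hc => ?_) (fun hc => ?_)
  · obtain ⟨⟨hr, hg⟩, hlt⟩ := hcond.1 hc
    have hsn : fa.toNat + fb.toNat + i % n ≤ n := hg.2.1.le
    refine Runs.setSeq (lt_pow_five hn (hsize ▸ hsn)) (Runs.set (le_pow_five hn ?_) ?_)
    · simp [hi']; omega
    -- The record size never drops during the search, so a new record also beats the initial one
    -- strictly.
    · have hold : m.reg 1 ≤ m₁.reg 1 := by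
        rcases hI with ⟨-, h⟩ | ⟨_, -, -, -, -, -, h⟩ <;> omega
      refine ⟨Or.inr ⟨i, hi, by simp [hi'], hr, hg, by simp [hsize], ?_⟩, fun w hw hrw hgw => ?_⟩
      · simp [hsize]; omega
      · simp only [hsize, Memory.setReg_reg]
        simp
        rcases Nat.lt_succ_iff_lt_or_eq.1 hw with h | rfl
        · have := hI' w h hrw hgw; omega
        · exact le_rfl
  · have hc' := mt hcond.2 (not_not.2 hc)
    refine Runs.nop ⟨by simpa using hI, fun w hw hrw hgw => ?_⟩
    simp only [Memory.setReg_reg]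
    simp
    rcases Nat.lt_succ_iff_lt_or_eq.1 hw with h | rfl
    · exact hI' w h hrw hgw
    · exact not_lt.1 fun hlt => hc' ⟨⟨hrw, hgw⟩, hlt⟩

end Selection
end WordRAM

/-! ### Recovering an optimal selection from the table. -/

namespace WordRAM

open Finset
open scoped Classical

section Selection

variable {n : ℕ} {G : SimpleGraph (Fin n)} {m : Memory} {a b : Fin n} {lab : Fin n → ℕ}
  {conn fa fb : Bool}

/-- The best set found so far: register `1` holds its size, or `0` if none has been found, and
array `1` its indicator vector. -/
def Best (G : SimpleGraph (Fin n)) (conn : Bool) (m : Memory) : Prop :=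
  m.reg 1 = 0 ∨ ∃ S, Target G conn S ∧ S.card = m.reg 1 ∧ ∀ v : Fin n, m.arr 1 v ≠ 0 ↔ v ∈ S

theorem Best.frame (h : Best G conn m) {R A : List ℕ} {m' : Memory} (hF : Frame R A m m')
    (hR : 1 ∉ R) (hA : 1 ∉ A) : Best G conn m' := by
  unfold Best
  rw [hF.reg 1 hR, hF.arr 1 hA]
  exact h

/-- Recover from the table a selection of items with the weight in register `12`, and mark it in
array `7`. Items are skipped whenever possible. -/
def backtrack : Prog :=
  forLoop 6 0 (.seq (.set 7 (.reg 0 - 1 - .reg 6))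
    (.cond (.arr 6 (.reg 7 * .reg 4 + .reg 12)) (.store 7 (.reg 7) 0)
      (.seq (.store 7 (.reg 7) 1) (.set 12 (.reg 12 - .arr 5 (.reg 7))))))

/-- Items are treated from the last to the first. The remaining weight stays reachable with the
untreated items, and the chosen items account for the rest. -/
theorem runs_backtrack (hn : 3 ≤ n) (h0 : m.reg 0 = n) (h4 : m.reg 4 = n ^ 4) (f : ℕ → ℕ)
    (hf : ∀ k < n, m.arr 5 k = f k)
    (ht : ∀ k ≤ n, ∀ w < n ^ 4, m.arr 6 (k * n ^ 4 + w) = if Reach f k w then 1 else 0)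
    (hw : m.reg 12 < n ^ 4) (hr : Reach f n (m.reg 12)) :
    Runs (n ^ 5) (loopBound n) backtrack m fun m' => ∃ I : Finset ℕ,
      (∀ k < n, m'.arr 7 k = if k ∈ I then 1 else 0) ∧ (∀ k ∈ I, f k ≠ 0) ∧
      m.reg 12 = ∑ k ∈ I, f k := by
  refine Runs.forVertex hn (fun j m' => m'.reg 12 < n ^ 4 ∧ Reach f (n - j) (m'.reg 12) ∧
      ∃ I : Finset ℕ, (∀ k ∈ I, n - j ≤ k) ∧
      (∀ k, n - j ≤ k → k < n → m'.arr 7 k = if k ∈ I then 1 else 0) ∧ (∀ k ∈ I, f k ≠ 0) ∧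
      m.reg 12 = m'.reg 12 + ∑ k ∈ I, f k) h0 (by decide) (by decide) (by decide) ?_ ?_ ?_
  · refine ⟨by simpa using hw, by simpa using hr, ∅, by simp, fun k hk hk' => by omega, by simp,
      by simp⟩
  · rintro j m₁ hj hF ⟨hw₁, hr₁, I, hI, harr, hne, hsum⟩
    have h0₁ : m₁.reg 0 = n := (hF.reg 0 (by decide)).trans h0
    have h4₁ : m₁.reg 4 = n ^ 4 := (hF.reg 4 (by decide)).trans h4
    obtain ⟨i, hi⟩ : ∃ i, n - 1 - j = i := ⟨_, rfl⟩
    have hin : i < n := by omega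
    have e1 : n - (j : ℕ) = i + 1 := by omega
    have e2 : n - ((j : ℕ) + 1) = i := by omega
    have ht₁ : m₁.arr 6 (i * n ^ 4 + m₁.reg 12) = if Reach f i (m₁.reg 12) then 1 else 0 := by
      rw [hF.arr 6 (by decide)]; exact ht i hin.le _ hw₁
    have hf₁ : m₁.arr 5 i = f i := by rw [hF.arr 5 (by decide)]; exact hf i hin
    rw [e1] at hr₁ hI harr
    refine Runs.setSeq (lt_pow_five hn (by simp [h0₁, hj]; omega)) (Runs.cond (fun hc => ?_)
      (fun hc => ?_))
    · have hri : Reach f i (m₁.reg 12) := by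
        by_contra hcon
        simp [h0₁, hj, hi, h4₁, ht₁, hcon] at hc
      refine Runs.store (lt_pow_five hn (by simp)) ?_
      rw [e2]
      refine ⟨by simpa using hw₁, by simpa using hri, I, fun k hk => (hI k hk).trans' (by omega),
        fun k hk hkn => ?_, hne, by simpa using hsum⟩
      by_cases hki : k = i
      · have : i ∉ I := fun h => by have := hI i h; omega
        simp [h0₁, hj, hi, hki, this]
      · simp [h0₁, hj, hi, hki, harr k (by omega) hkn]
    · have hri : ¬ Reach f i (m₁.reg 12) := by
        intro hcon
        simp [h0₁, hj, hi, h4₁, ht₁, hcon] at hc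
      obtain ⟨hle, hri'⟩ := hr₁.resolve_left hri
      have hiI : i ∉ I := fun h => by have := hI i h; omega
      refine Runs.storeSeq (lt_pow_five hn (by simp; omega)) (Runs.set (le_pow_five hn ?_) ?_)
      · simp; omega
      · rw [e2]
        refine ⟨?_, ?_, insert i I, ?_, ?_, ?_, ?_⟩
        · simp; omega
        · simpa [h0₁, hj, hi, hf₁] using hri'
        · intro k hk
          rcases mem_insert.1 hk with rfl | hk
          · exact le_rfl
          · exact (hI k hk).trans' (by omega)
        · intro k hk hkn
          by_cases hki : k = i
          · simp [h0₁, hj, hi, hki]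
          · simp [h0₁, hj, hi, hki, harr k (by omega) hkn]
        · intro k hk
          rcases mem_insert.1 hk with rfl | hk
          -- An item of weight 0 would leave the remaining weight unchanged, so skipping it would
          -- have been possible. This keeps forbidden pieces out of the selection.
          · intro hfk
            rw [hfk, Nat.sub_zero] at hri'
            exact hri hri'
          · exact hne k hk
        · rw [sum_insert hiI]
          simp [h0₁, hj, hi, hf₁]
          omega
  · rintro m₁ _ ⟨-, hr₁, I, -, harr, hne, hsum⟩
    rw [Nat.sub_self] at hr₁ harr
    exact ⟨I, fun k hk => harr k (Nat.zero_le k) hk, hne, by rw [hsum, show m₁.reg 12 = 0 from hr₁, zero_add]⟩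

/-- Write the selected set to array `1`. -/
def writeSelection (fa fb : Bool) : Prog :=
  forLoop 6 0 (.store 1 (.reg 6) ((Exp.reg 6).eqb (.reg 2) * .const fa.toNat +
    (Exp.reg 6).eqb (.reg 3) * .const fb.toNat + other (.reg 6) * .arr 7 (.arr 3 (.reg 6))))

theorem runs_writeSelection (hn : 3 ≤ n) (h : Prepared G a b lab m) (hab : a ≠ b) {I : Finset ℕ}
    (hlt : ∀ v, lab v < n) (hI : ∀ k < n, m.arr 7 k = if k ∈ I then 1 else 0) :
    Runs (n ^ 5) (loopBound n) (writeSelection fa fb) m fun m' => ∀ v : Fin n,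
      m'.arr 1 v ≠ 0 ↔ if v = a then fa = true else if v = b then fb = true else lab v ∈ I := by
  refine Runs.forVertex hn (fun i m' => ∀ v : Fin n, (v : ℕ) < i → (m'.arr 1 v ≠ 0 ↔
      if v = a then fa = true else if v = b then fb = true else lab v ∈ I))
    h.graph.reg (by simp [Prog.regs]) (by simp [Prog.regs]) (by decide) (by simp) ?_
    (fun m' _ hI v => hI v v.2)
  intro i m₁ hi hF hI₁
  have h₁ := h.frame hF (by simp [Prog.regs]) (by simp [Prog.arrs])
  have h7 : m₁.arr 7 (lab i) = if lab i ∈ I then 1 else 0 := by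
    rw [hF.arr 7 (by simp [Prog.arrs])]; exact hI _ (hlt i)
  have hval : ((Exp.reg 6).eqb (.reg 2) * .const fa.toNat + (Exp.reg 6).eqb (.reg 3) *
      .const fb.toNat + other (.reg 6) * .arr 7 (.arr 3 (.reg 6))).eval m₁ =
      if i = a then fa.toNat else if i = b then fb.toNat else if lab i ∈ I then 1 else 0 := by
    rw [Exp.eval_add, Exp.eval_add, Exp.eval_mul _ (other _),
      eval_other h₁.top₁ h₁.top₂ (v := i) (by simp [hi])]
    simp only [Exp.eval_mul, Exp.eval_eqb, Exp.eval_reg, Exp.eval_const, Exp.eval_arr, hi, h₁.top₁,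
      h₁.top₂, h₁.label, h7, Fin.val_inj]
    by_cases h1 : i = a
    · have h2 : ¬ i = b := fun h => hab (h1.symm.trans h)
      simp only [h1, hab]; simp
    · by_cases h2 : i = b
      · simp only [h2, hab.symm]; simp
      · by_cases h3 : lab i ∈ I <;> simp [h1, h2, h3]
  refine Runs.store (hval ▸ lt_pow_five hn ?_) fun v hv => ?_
  · have h1 := fa.toNat_le
    have h2 := fb.toNat_le
    split_ifs <;> omega
  · rw [hval]
    by_cases hvi : v = i
    · subst hvi
      simp [hi]
      split_ifs <;> simp_all
    · have : (v : ℕ) ≠ i := fun h => hvi (Fin.ext h)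
      simp only [Memory.setReg_arr, Memory.setArr_arr_apply, Exp.eval_reg, hi, this, and_false, if_false]
      exact hI₁ v (by omega)

/-- Find the largest target that is closed and contains `a` and `b` as prescribed. -/
def select (conn fa fb : Bool) : Prog :=
  .seq (items conn fa fb) (.seq table (.seq (search conn fa fb)
    (.cond (.reg 11) (.seq (.set 12 (.reg 11 - 1)) (.seq backtrack (writeSelection fa fb))) .nop)))

@[simp] theorem items_regs : (items conn fa fb).regs = [6, 6] := rfl
@[simp] theorem items_arrs : (items conn fa fb).arrs = [5] := rfl
@[simp] theorem search_regs : (search conn fa fb).regs = [11, 6, 1, 11, 6] := rfl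
@[simp] theorem search_arrs : (search conn fa fb).arrs = [] := rfl
@[simp] theorem writeSelection_regs : (writeSelection fa fb).regs = [6, 6] := rfl
@[simp] theorem writeSelection_arrs : (writeSelection fa fb).arrs = [1] := rfl

theorem runs_select (hn : 3 ≤ n) (hab : a ≠ b) (hlab : IsLabelling G a b lab)
    (h : Prepared G a b lab m) (hbest : Best G conn m) :
    Runs (n ^ 5) (loopBound n) (select conn fa fb) m fun m' => Best G conn m' ∧
      m.reg 1 ≤ m'.reg 1 ∧ ∀ S, NbrClosed G a b S → Target G conn S → fa = decide (a ∈ S) →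
        fb = decide (b ∈ S) → S.card ≤ m'.reg 1 := by
  set f : ℕ → ℕ := fun k => itemWeight conn fa fb n (pieceWeight G a b lab k) with hfdef
  refine Runs.seq (runs_items hn h) fun m₁ hF₁ hf₁ => ?_
  have h₁ := h.frame hF₁ (by simp) (by simp)
  have hb₁ := hbest.frame hF₁ (by simp) (by simp)
  have r₁ : m₁.reg 1 = m.reg 1 := hF₁.reg 1 (by simp)
  refine Runs.seq (runs_table hn h₁.graph.reg h₁.bound f hf₁) fun m₂ hF₂ ht₂ => ?_
  have h₂ := h₁.frame hF₂ (by decide) (by decide)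
  have hb₂ := hb₁.frame hF₂ (by decide) (by decide)
  have r₂ : m₂.reg 1 = m.reg 1 := (hF₂.reg 1 (by decide)).trans r₁
  have hf₂ : ∀ k < n, m₂.arr 5 k = f k := fun k hk => by rw [hF₂.arr 5 (by decide)]; exact hf₁ k hk
  refine Runs.seq (runs_search hn h₂ f (ht₂ n le_rfl)) fun m₃ hF₃ hs₃ => ?_
  have h₃ := h₂.frame hF₃ (by simp) (by simp)
  obtain ⟨hcase, hmax⟩ := hs₃
  -- Completeness uses only that the search inspects every total below n^4; the recovery of the set
  -- is not involved.
  have hcomplete : ∀ S, NbrClosed G a b S → Target G conn S → fa = decide (a ∈ S) →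
      fb = decide (b ∈ S) → S.card ≤ m₃.reg 1 := by
    intro S hcl hT ha hb
    obtain ⟨w, hw, ⟨I, hI, hwI⟩, hgood, hcard⟩ := exists_good hab hlab hcl hT ha hb
    rw [hcard]
    exact hmax w hw (hwI ▸ reach_of_sum (f := f) hI) hgood
  -- After a success register `1` is ahead of array `1`, and rewriting the array restores `Best`;
  -- after a failure neither has changed.
  refine Runs.cond (fun hc => ?_) (fun hc => ?_)
  · obtain ⟨w, hw, hw11, hrw, hgood, hsize, hlt⟩ := hcase.resolve_left fun hh => hc hh.1
    refine Runs.setSeq (le_pow_five hn (by simp [hw11, hw.le])) ?_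
    have hF₄ : Frame [12] [] m₃ (m₃.setReg 12 ((Exp.reg 11 - 1 : Exp).eval m₃)) :=
      ⟨fun x hx => by simp at hx; simp [hx], fun _ _ => rfl⟩
    generalize hm₄ : m₃.setReg 12 ((Exp.reg 11 - 1 : Exp).eval m₃) = m₄ at hF₄ ⊢
    have h12 : m₄.reg 12 = w := by simp [← hm₄, hw11]
    have h₄ := h₃.frame hF₄ (by decide) (by decide)
    have r₄ : m₄.reg 1 = m₃.reg 1 := hF₄.reg 1 (by decide)
    refine Runs.seq (runs_backtrack hn h₄.graph.reg h₄.bound f (fun k hk => ?_)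
      (fun k hk w hw => ?_) (h12 ▸ hw) (h12 ▸ hrw)) fun m₅ hF₅ hb₅ => ?_
    · rw [hF₄.arr 5 (by decide), hF₃.arr 5 (by simp), hf₂ k hk]
    · rw [hF₄.arr 6 (by decide), hF₃.arr 6 (by simp), ht₂ k hk w hw]
    obtain ⟨I, hI, hne, hsum⟩ := hb₅
    have h₅ := h₄.frame hF₅ (by decide) (by decide)
    have r₅ : m₅.reg 1 = m₃.reg 1 := (hF₅.reg 1 (by decide)).trans r₄
    refine (runs_writeSelection hn h₅ hab hlab.lt hI).mono fun m₆ hF₆ hw₆ => ?_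
    have r₆ : m₆.reg 1 = m₃.reg 1 := (hF₆.reg 1 (by simp)).trans r₅
    rw [r₆]
    refine ⟨Or.inr ⟨univ.filter fun v => m₆.arr 1 v ≠ 0, ?_⟩, by omega, hcomplete⟩
    obtain ⟨hT, hcard⟩ := target_of_good hab hlab (conn := conn) (fa := fa) (fb := fb) (I := I) hne
      (S := univ.filter fun v => m₆.arr 1 v ≠ 0) (by simp [hw₆]) (by simp [hw₆, hab.symm])
      (fun v hva hvb => by simp [hw₆, hva, hvb]) (h12 ▸ hsum) hgood
    exact ⟨hT, by rw [hcard, r₆, hsize], by simp⟩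
  · have hh : m₃.reg 1 = m₂.reg 1 := by
      rcases hcase with hh | ⟨w, -, hw, -⟩
      · exact hh.2
      · simp [hw] at hc
    refine Runs.nop ⟨?_, by omega, hcomplete⟩
    unfold Best
    rw [hh, hF₃.arr 1 (by simp)]
    exact hb₂

end Selection
end WordRAM

/-! ### Growing connected sets of size ⌈n/2⌉. -/

namespace WordRAM

open Finset
open scoped Classical

section Growth

variable {n : ℕ} {G : SimpleGraph (Fin n)} {m : Memory} {x w : Fin n} {conn : Bool}

/-- Array `8` holds the indicator vector of `S`, and register `12` its size. -/
def Holds (S : Finset (Fin n)) (m : Memory) : Prop :=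
  (∀ v : Fin n, m.arr 8 v = if v ∈ S then 1 else 0) ∧ m.reg 12 = S.card

/-- Add neighbours of the vertex in register `c`, other than the vertex in register `o`, to the
set in array `8`, as long as its size is below register `5`. -/
def addNbrs (c o : ℕ) : Prog :=
  forLoop 7 0 (.cond (.arr 0 (.reg c * .reg 0 + .reg 7) * (1 - .arr 8 (.reg 7)) *
      (1 - (Exp.reg 7).eqb (.reg o)) * (Exp.reg 12).ltb (.reg 5))
    (.seq (.store 8 (.reg 7) 1) (.set 12 (.reg 12 + 1))) .nop)

@[simp] theorem addNbrs_regs (c o : ℕ) : (addNbrs c o).regs = [7, 12, 7] := rfl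
@[simp] theorem addNbrs_arrs (c o : ℕ) : (addNbrs c o).arrs = [8] := rfl

theorem runs_addNbrs (hn : 3 ≤ n) {c o : ℕ} (hc : c ∉ [7, 12]) (ho : o ∉ [7, 12])
    (h : HasGraph G m) {u : Fin n} (hu : m.reg c = u) (hw : m.reg o = w) {S : Finset (Fin n)}
    (hS : Holds S m) (hcard : S.card ≤ m.reg 5) :
    Runs (n ^ 5) (loopBound n) (addNbrs c o) m fun m' => ∃ T, Holds T m' ∧ S ⊆ T ∧
      (∀ v ∈ T, v ∈ S ∨ G.Adj u v ∧ v ≠ w) ∧ T.card ≤ m.reg 5 ∧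
      (T.card = m.reg 5 ∨ ∀ v, G.Adj u v → v = w ∨ v ∈ T) := by
  refine Runs.forVertex hn (fun j m' => ∃ T, Holds T m' ∧ S ⊆ T ∧
      (∀ v ∈ T, v ∈ S ∨ G.Adj u v ∧ v ≠ w) ∧ T.card ≤ m.reg 5 ∧
      (T.card = m.reg 5 ∨ ∀ v : Fin n, (v : ℕ) < j → G.Adj u v → v = w ∨ v ∈ T))
    h.reg (by simp [Prog.regs]) (by simp [Prog.regs]) (by decide)
    ⟨S, by simpa [Holds] using hS, Subset.rfl, fun v hv => Or.inl hv, hcard, by simp⟩ ?_ ?_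
  · rintro j m₁ hj hF ⟨T, ⟨hT8, hT12⟩, hST, hTS, hTc, hdone⟩
    have h₁ := h.frame hF (by simp [Prog.regs]) (by simp [Prog.arrs])
    have hu₁ : m₁.reg c = u := (hF.reg c (by simpa [Prog.regs] using hc)).trans hu
    have hw₁ : m₁.reg o = w := (hF.reg o (by simpa [Prog.regs] using ho)).trans hw
    have h5₁ : m₁.reg 5 = m.reg 5 := hF.reg 5 (by simp [Prog.regs])
    have hcond : (Exp.arr 0 (.reg c * .reg 0 + .reg 7) * (1 - .arr 8 (.reg 7)) *
        (1 - (Exp.reg 7).eqb (.reg o)) * (Exp.reg 12).ltb (.reg 5)).eval m₁ ≠ 0 ↔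
        G.Adj u j ∧ j ∉ T ∧ j ≠ w ∧ T.card < m.reg 5 := by
      simp only [Exp.eval_mul, Exp.eval_sub, Exp.eval_arr, Exp.eval_add, Exp.eval_reg, Exp.eval_one,
        Exp.eval_eqb, Exp.eval_ltb, hu₁, hw₁, h5₁, hj, h₁.reg, h₁.arr, hT8, hT12, Fin.val_inj]
      by_cases h1 : G.Adj u j <;> by_cases h2 : j ∈ T <;> by_cases h3 : j = w <;>
        by_cases h4 : T.card < m.reg 5 <;> simp [h1, h2, h3, h4]
    refine Runs.cond (fun hc => ?_) (fun hc => ?_)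
    · obtain ⟨hadj, hjT, hjw, hlt⟩ := hcond.1 hc
      have hn5 : T.card ≤ n := by simpa using card_le_univ T
      refine Runs.storeSeq (lt_pow_five hn (by simp; omega)) (Runs.set (le_pow_five hn ?_) ?_)
      · have : n < n ^ 4 := by
          calc n = n ^ 1 := (pow_one n).symm
            _ < n ^ 4 := Nat.pow_lt_pow_right (by omega) (by omega)
        simp [hT12]; omega
      · refine ⟨insert j T, ⟨fun v => ?_, ?_⟩, hST.trans (subset_insert _ _), fun v hv => ?_, ?_, ?_⟩
        · by_cases hvj : v = j
          · simp [hvj, hj]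
          · have : (v : ℕ) ≠ j := fun h => hvj (Fin.ext h)
            simp [hvj, hj, this, hT8]
        · simp [hT12, card_insert_of_notMem hjT]
        · rcases mem_insert.1 hv with rfl | hv
          · exact Or.inr ⟨hadj, hjw⟩
          · exact hTS v hv
        · rw [card_insert_of_notMem hjT]; omega
        · rcases hdone with hd | hd
          · omega
          · refine Or.inr fun v hv huv => ?_
            rcases Nat.lt_succ_iff_lt_or_eq.1 hv with h | h
            · exact (hd v h huv).imp id (mem_insert_of_mem ·)
            · exact Or.inr (Fin.ext h ▸ mem_insert_self _ _)
    · have hc' := mt hcond.2 (not_not.2 hc)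
      refine Runs.nop ⟨T, ⟨by simpa using hT8, by simpa using hT12⟩, hST, hTS, hTc, ?_⟩
      by_cases hfull : T.card = m.reg 5
      · exact Or.inl hfull
      · refine Or.inr fun v hv huv => ?_
        rcases Nat.lt_succ_iff_lt_or_eq.1 hv with h | h
        · exact hdone.resolve_left hfull v h huv
        · rw [Fin.ext h] at huv ⊢
          by_contra! hno
          exact hc' ⟨huv, hno.2, hno.1, by omega⟩
  · rintro m₁ - ⟨T, hT, hST, hTS, hTc, hdone⟩
    exact ⟨T, hT, hST, hTS, hTc, hdone.imp id fun hd v => hd v v.2⟩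

/-- The properties of the sets grown from `x` avoiding `w`, up to size `k`. -/
structure Grown (G : SimpleGraph (Fin n)) (x w : Fin n) (k : ℕ) (S : Finset (Fin n)) : Prop where
  mem : x ∈ S
  notMem : w ∉ S
  card_le : S.card ≤ k
  conn : ConnSet G S
  nbrs : (∀ v, G.Adj x v → v = w ∨ v ∈ S) ∨ k ≤ degIn G S x + 1

/-- Both alternatives in `nbrs` survive enlargement, so only the initial step at `x` has to
establish one of them. -/
theorem Grown.step {k : ℕ} {S T : Finset (Fin n)} (h : Grown G x w k S) {u : Fin n} (hu : u ∈ S)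
    (hST : S ⊆ T) (hTS : ∀ v ∈ T, v ∈ S ∨ G.Adj u v ∧ v ≠ w) (hT : T.card ≤ k) :
    Grown G x w k T where
  mem := hST h.mem
  notMem hw := (hTS w hw).elim h.notMem fun hh => hh.2 rfl
  card_le := hT
  conn := h.conn.of_nbrs hu hST fun v hv => (hTS v hv).imp id And.left
  nbrs := h.nbrs.imp (fun hh v hv => (hh v hv).imp id (hST ·))
    fun hh => hh.trans (Nat.add_le_add_right (degIn_mono G hST x) 1)

/-- The members of `S` among the first `i` vertices have all their neighbours, other than `w`,
in `S`. -/
def ClosedBelow (G : SimpleGraph (Fin n)) (w : Fin n) (i : ℕ) (S : Finset (Fin n)) : Prop :=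
  ∀ u ∈ S, (u : ℕ) < i → ∀ v, G.Adj u v → v = w ∨ v ∈ S

/-- Add neighbours of all members of the set in array `8`. -/
def addRound (o : ℕ) : Prog := forLoop 6 0 (.cond (.arr 8 (.reg 6)) (addNbrs 6 o) .nop)

@[simp] theorem addRound_regs (o : ℕ) : (addRound o).regs = [6, 7, 12, 7, 6] := rfl
@[simp] theorem addRound_arrs (o : ℕ) : (addRound o).arrs = [8] := rfl

/-- A round fills the set up, enlarges it, or finds it closed; by induction `r` rounds give at least
`r` vertices unless growth has ended. -/
theorem runs_addRound (hn : 3 ≤ n) {o k r : ℕ} (ho : o ∉ [6, 7, 12]) (h : HasGraph G m)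
    (hw : m.reg o = w) (h5 : m.reg 5 = k) {S : Finset (Fin n)} (hS : Holds S m)
    (hg : Grown G x w k S) (hr : S.card = k ∨ r ≤ S.card ∨ ClosedBelow G w n S) :
    Runs (n ^ 5) (loopBound n) (addRound o) m fun m' => ∃ T, Holds T m' ∧ Grown G x w k T ∧
      (T.card = k ∨ r + 1 ≤ T.card ∨ ClosedBelow G w n T) := by
  -- The fourth alternative exists only during the round: no growth beyond `r` is claimed yet, and
  -- the members among the first `i` vertices are closed.
  refine Runs.forVertex hn (fun i m' => ∃ T, Holds T m' ∧ Grown G x w k T ∧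
      (T.card = k ∨ r + 1 ≤ T.card ∨ ClosedBelow G w n T ∨ r ≤ T.card ∧ ClosedBelow G w i T))
    h.reg (by simp [Prog.regs]) (by simp [Prog.regs]) (by decide) ⟨S, by simpa [Holds] using hS, hg, ?_⟩ ?_ ?_
  · rcases hr with hr | hr | hr
    · exact Or.inl hr
    · exact Or.inr (Or.inr (Or.inr ⟨hr, fun u _ hu => by omega⟩))
    · exact Or.inr (Or.inr (Or.inl hr))
  · rintro i m₁ hi hF ⟨T, hT, hgT, hcase⟩
    have h₁ := h.frame hF (by simp [Prog.regs]) (by simp [Prog.arrs])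
    have hw₁ : m₁.reg o = w := (hF.reg o (by simp [Prog.regs] at ho ⊢; tauto)).trans hw
    have h5₁ : m₁.reg 5 = k := (hF.reg 5 (by simp [Prog.regs])).trans h5
    have hval : (Exp.arr 8 (.reg 6)).eval m₁ = if i ∈ T then 1 else 0 := by simp [hi, hT.1]
    refine Runs.cond (fun hc => ?_) (fun hc => ?_)
    · have hiT : i ∈ T := by
        by_contra hno; rw [hval, if_neg hno] at hc; exact hc rfl
      refine (runs_addNbrs hn (by decide) (by simp at ho ⊢; tauto) h₁ hi hw₁ hT
        (h5₁ ▸ hgT.card_le)).mono fun m₂ _ hm₂ => ?_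
      obtain ⟨T', hT', hsub, hnew, hcard, hdone⟩ := hm₂
      rw [h5₁] at hcard hdone
      refine ⟨T', by simpa [Holds] using hT', hgT.step hiT hsub hnew hcard, ?_⟩
      have hle := card_le_card hsub
      rcases hcase with hcase | hcase | hcase | ⟨hcase, hcl⟩
      · left; omega
      · right; left; omega
      · right; right; left
        have : T' = T := Subset.antisymm (fun v hv => (hnew v hv).elim id fun hh =>
          (hcase i hiT i.2 v hh.1).resolve_left hh.2) hsub
        rw [this]; exact hcase
      · by_cases heq : T = T'
        · subst heq
          rcases hdone with hd | hd
          · exact Or.inl hd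
          · refine Or.inr (Or.inr (Or.inr ⟨hcase, fun u hu hui v huv => ?_⟩))
            rcases Nat.lt_succ_iff_lt_or_eq.1 hui with hh | hh
            · exact hcl u hu hh v huv
            · rw [Fin.ext hh] at huv; exact hd v huv
        · have := card_lt_card (hsub.ssubset_of_ne heq)
          right; left; omega
    · have hiT : i ∉ T := by
        intro hh; rw [hval, if_pos hh] at hc; exact one_ne_zero hc
      refine Runs.nop ⟨T, by simpa [Holds] using hT, hgT, ?_⟩
      refine hcase.imp id (Or.imp id (Or.imp id (And.imp id fun hcl u hu hui v huv => ?_)))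
      rcases Nat.lt_succ_iff_lt_or_eq.1 hui with hh | hh
      · exact hcl u hu hh v huv
      · exact absurd (Fin.ext hh ▸ hu) hiT
  · rintro m₁ - ⟨T, hT, hgT, hcase⟩
    refine ⟨T, hT, hgT, ?_⟩
    rcases hcase with hcase | hcase | hcase | ⟨-, hcl⟩
    · exact Or.inl hcase
    · exact Or.inr (Or.inl hcase)
    · exact Or.inr (Or.inr hcase)
    · exact Or.inr (Or.inr hcl)

/-- Grow a connected set of size `⌈n / 2⌉` from the vertex in register `c`, avoiding the vertex
in register `o`, and record it if it is better than the best set so far. -/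
def grow (c o : ℕ) : Prog :=
  .seq (forLoop 6 0 (.store 8 (.reg 6) 0)) (.seq (.store 8 (.reg c) 1) (.seq (.set 12 1)
  (.seq (addNbrs c o) (.seq (forLoop 10 0 (addRound o))
  (.cond ((Exp.reg 12).eqb (.reg 5) * (Exp.reg 1).ltb (.reg 5))
    (.seq (forLoop 6 0 (.store 1 (.reg 6) (.arr 8 (.reg 6)))) (.set 1 (.reg 5))) .nop)))))

@[simp] theorem grow_regs (c o : ℕ) :
    (grow c o).regs = [6, 6, 12, 7, 12, 7, 10, 6, 7, 12, 7, 6, 10, 6, 6, 1] := rfl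
@[simp] theorem grow_arrs (c o : ℕ) : (grow c o).arrs = [8, 8, 8, 8, 1] := rfl

theorem runs_grow (hn : 3 ≤ n) {c o : ℕ} (hc : c = 2 ∨ c = 3) (ho : o = 2 ∨ o = 3)
    (h : HasGraph G m) (hx : m.reg c = x) (hw : m.reg o = w) (hxw : x ≠ w)
    (h5 : m.reg 5 = (n + 1) / 2) (hdeg : ∀ v, v ≠ x → v ≠ w → degIn G univ v ≤ 2)
    (hbest : Best G conn m) :
    Runs (n ^ 5) (loopBound n) (grow c o) m fun m' => Best G conn m' ∧ m.reg 1 ≤ m'.reg 1 ∧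
      ((n + 1) / 2 ≤ m'.reg 1 ∨ ∃ S : Finset (Fin n), x ∈ S ∧ (∀ u ∈ S, ∀ v, G.Adj u v → v = w ∨ v ∈ S) ∧
        S.card < (n + 1) / 2) := by
  have hcR : ∀ y ∈ [6, 7, 10, 12], c ≠ y := by rcases hc with rfl | rfl <;> decide
  have hoR : ∀ y ∈ [6, 7, 10, 12], o ≠ y := by rcases ho with rfl | rfl <;> decide
  simp only [List.forall_mem_cons, List.not_mem_nil, false_imp_iff, implies_true, and_true] at hcR hoR
  obtain ⟨k, hk⟩ : ∃ k, (n + 1) / 2 = k := ⟨_, rfl⟩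
  rw [hk] at h5 ⊢
  refine Runs.seq (Q := fun m' => ∀ v : Fin n, m'.arr 8 v = 0) ?_ ?_
  · refine Runs.forVertex hn (fun i m' => ∀ v : Fin n, (v : ℕ) < i → m'.arr 8 v = 0)
      h.reg (by decide) (by decide) (by decide) (by simp) ?_ (fun _ _ hI v => hI v v.2)
    intro i m₁ hi hF hI
    refine Runs.store (lt_pow_five hn (by simp)) fun v hv => ?_
    by_cases hv' : (v : ℕ) = i
    · simp [hv', hi]
    · simp [hi, hv', hI v (by omega)]
  intro m₁ hF₁ h8₁
  refine Runs.storeSeq (lt_pow_five hn (by simp; omega)) (Runs.setSeq (lt_pow_five hn (by simp; omega)) ?_)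
  have hx₁ : m₁.reg c = x := (hF₁.reg c (by simp [forLoop, Prog.regs]; omega)).trans hx
  have hF₂ : Frame [6, 12] [8] m ((m₁.setArr 8 ((Exp.reg c).eval m₁) ((1 : Exp).eval m₁)).setReg 12
      ((1 : Exp).eval (m₁.setArr 8 ((Exp.reg c).eval m₁) ((1 : Exp).eval m₁)))) := by
    refine (hF₁.mono (by decide) (by decide)).trans ⟨fun y hy => ?_, fun y hy => ?_⟩
    · simp at hy; simp [hy]
    · simp at hy; simp [Memory.setArr_arr, hy]
  have hH₂ : Holds {x} ((m₁.setArr 8 ((Exp.reg c).eval m₁) ((1 : Exp).eval m₁)).setReg 12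
      ((1 : Exp).eval (m₁.setArr 8 ((Exp.reg c).eval m₁) ((1 : Exp).eval m₁)))) := by
    refine ⟨fun v => ?_, by simp⟩
    simp [hx₁, h8₁, Fin.val_inj]
  generalize ((m₁.setArr 8 ((Exp.reg c).eval m₁) ((1 : Exp).eval m₁)).setReg 12
      ((1 : Exp).eval (m₁.setArr 8 ((Exp.reg c).eval m₁) ((1 : Exp).eval m₁)))) = m₂ at hF₂ hH₂ ⊢
  have h₂ := h.frame hF₂ (by decide) (by decide)
  have h5₂ : m₂.reg 5 = k := (hF₂.reg 5 (by decide)).trans h5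
  refine Runs.seq (runs_addNbrs hn (w := w) (u := x) (by simp; omega) (by simp; omega) h₂
    ((hF₂.reg c (by simp; omega)).trans hx) ((hF₂.reg o (by simp; omega)).trans hw) hH₂
    (by simp; omega)) fun m₃ hF₃ hm₃ => ?_
  obtain ⟨T, hT, hsub, hnew, hcard, hdone⟩ := hm₃
  rw [h5₂] at hcard hdone
  -- Growth starts with the neighbours of `x` alone: either all but `w` fit, or the size limit is
  -- reached with every other member adjacent to `x`.
  have hgT : Grown G x w k T := by
    refine ⟨hsub (mem_singleton_self x), fun hwT => ?_, hcard,
      (ConnSet.singleton x).of_nbrs (mem_singleton_self x) hsub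
        (fun v hv => (hnew v hv).imp id And.left), ?_⟩
    · rcases hnew w hwT with hh | hh
      · exact hxw (mem_singleton.1 hh).symm
      · exact hh.2 rfl
    · refine hdone.symm.imp id fun hh => ?_
      rw [← hh]
      have : T ⊆ insert x (T.filter fun v => G.Adj x v) := by
        intro v hv
        rcases hnew v hv with hv' | hv'
        · exact mem_insert.2 (Or.inl (mem_singleton.1 hv'))
        · exact mem_insert_of_mem (mem_filter.2 ⟨hv, hv'.1⟩)
      exact (card_le_card this).trans (card_insert_le _ _)
  have hF₃' : Frame [6, 7, 12] [8] m m₃ := (hF₂.mono (by decide) (by decide)).trans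
    (hF₃.mono (by simp) (by simp))
  refine Runs.seq (Q := fun m' => ∃ T, Holds T m' ∧ Grown G x w k T ∧
    (T.card = k ∨ ClosedBelow G w n T)) ?_ fun m₄ hF₄ hm₄ => ?_
  · refine Runs.forVertex hn (fun r m' => ∃ T, Holds T m' ∧ Grown G x w k T ∧
      (T.card = k ∨ r ≤ T.card ∨ ClosedBelow G w n T)) ((hF₃'.reg 0 (by decide)).trans h.reg)
      (by simp) (by simp) (by decide)
      ⟨T, by simpa [Holds] using hT, hgT, by simp⟩ ?_ ?_
    · rintro r m₄ hr hF ⟨S, hS, hgS, hcase⟩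
      have hF' : Frame [6, 7, 10, 12] [8] m m₄ := (hF₃'.mono (by decide) (by decide)).trans
        (hF.mono (by simp) (by simp))
      refine (runs_addRound hn (by simp; omega) (h.frame hF' (by decide) (by decide))
        ((hF'.reg o (by simp; omega)).trans hw) ((hF'.reg 5 (by decide)).trans h5) hS hgS
        hcase).mono fun m₅ _ hm₅ => ?_
      obtain ⟨S', hS', hh⟩ := hm₅
      exact ⟨S', by simpa [Holds] using hS', hh⟩
    · rintro m₄ - ⟨S, hS, hgS, hcase⟩
      refine ⟨S, hS, hgS, ?_⟩
      have := hgS.card_le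
      rcases hcase with hh | hh | hh
      · exact Or.inl hh
      -- After `n` rounds this would give n ≤ |S| ≤ ⌈n/2⌉, impossible for n ≥ 3.
      · omega
      · exact Or.inr hh
  obtain ⟨S, hS, hgS, hcase⟩ := hm₄
  have hF₄' : Frame [6, 7, 10, 12] [8] m m₄ := (hF₃'.mono (by decide) (by decide)).trans
    (hF₄.mono (by simp [forLoop, Prog.regs]) (by simp [forLoop, Prog.arrs]))
  have h5₄ : m₄.reg 5 = k := (hF₄'.reg 5 (by decide)).trans h5
  have h1₄ : m₄.reg 1 = m.reg 1 := hF₄'.reg 1 (by decide)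
  have hcond : ((Exp.reg 12).eqb (.reg 5) * (Exp.reg 1).ltb (.reg 5)).eval m₄ ≠ 0 ↔
      S.card = k ∧ m.reg 1 < k := by
    simp [hS.2, h5₄, h1₄, and_comm]
  refine Runs.cond (fun hh => ?_) (fun hh => ?_)
  · obtain ⟨hSk, hlt⟩ := hcond.1 hh
    refine Runs.seq (Q := fun m' => ∀ v : Fin n, m'.arr 1 v = m₄.arr 8 v) ?_ fun m₅ hF₅ hm₅ => ?_
    · refine Runs.forVertex hn (fun i m' => ∀ v : Fin n, (v : ℕ) < i → m'.arr 1 v = m₄.arr 8 v)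
        ((hF₄'.reg 0 (by decide)).trans h.reg) (by decide) (by decide) (by decide) (by simp) ?_
        (fun _ _ hI v => hI v v.2)
      intro i m₅ hi hF hI
      have h8 : m₅.arr 8 = m₄.arr 8 := hF.arr 8 (by decide)
      refine Runs.store ?_ fun v hv => ?_
      · simp only [Exp.eval_arr, Exp.eval_reg, hi, h8, hS.1]
        exact bit_lt hn _
      · by_cases hv' : (v : ℕ) = i
        · simp [hv', hi, h8]
        · simp [hi, hv', hI v (by omega)]
    · have h5₅ : m₅.reg 5 = k := (hF₅.reg 5 (by decide)).trans h5₄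
      refine Runs.set (lt_pow_five hn (by simp [h5₅]; omega)) ⟨Or.inr ⟨S, ⟨?_, fun _ => hgS.conn⟩,
        by simp [h5₅, hSk], fun v => ?_⟩, by simp [h5₅]; omega, Or.inl (by simp [h5₅])⟩
      · refine hgS.conn.isPDS_half hdeg (by simpa using hn) hgS.mem hgS.notMem
          (by simp [hSk, hk]) ?_
        rw [hSk]; exact hgS.nbrs
      · simp [hm₅, hS.1]
  · have hno := mt hcond.2 (not_not.2 hh)
    refine Runs.nop ⟨hbest.frame hF₄' (by decide) (by decide), h1₄.ge, ?_⟩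
    rw [h1₄]
    by_cases hle : k ≤ m.reg 1
    · exact Or.inl hle
    · have hSk : S.card ≠ k := fun hh => hno ⟨hh, by omega⟩
      have := hgS.card_le
      exact Or.inr ⟨S, hgS.mem, fun u hu => hcase.resolve_left hSk u hu u.2, by omega⟩

end Growth
end WordRAM

/-! ### The whole program, its correctness and its running time. -/

namespace WordRAM

open Finset
open scoped Classical

section Solution

variable {n : ℕ} {G : SimpleGraph (Fin n)} {m : Memory} {conn : Bool}

/-- The preparatory stages. -/
def prepare : Prog := .seq degrees (.seq chooseTop (.seq labels weights))

theorem runs_prepare (hn : 3 ≤ n) (h : HasGraph G m) :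
    Runs (n ^ 5) (loopBound n) prepare m fun m' => ∃ (a b : Fin n) (lab : Fin n → ℕ), a ≠ b ∧
      (∀ v, degIn G univ v ≤ degIn G univ a) ∧ (∀ v, v ≠ a → degIn G univ v ≤ degIn G univ b) ∧
      IsLabelling G a b lab ∧ Prepared G a b lab m' := by
  refine Runs.seq (runs_degrees hn h) fun m₁ hF₁ hd₁ => ?_
  have h₁ := h.frame hF₁ (by decide) (by decide)
  refine Runs.seq (runs_chooseTop hn h₁.reg (degIn G univ) hd₁) fun m₂ hF₂ hm₂ => ?_
  obtain ⟨a, b, hab, ha, hb, h2, h3, h4, h5⟩ := hm₂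
  have h₂ := h₁.frame hF₂ (by decide) (by decide)
  refine Runs.seq (runs_labels hn h₂ h2 h3) fun m₃ hF₃ hl₃ => ?_
  have h₃ := h₂.frame hF₃ (by decide) (by decide)
  have h2₃ := (hF₃.reg 2 (by decide)).trans h2
  have h3₃ := (hF₃.reg 3 (by decide)).trans h3
  refine (runs_weights hn h₃ h2₃ h3₃ _ (fun v => rfl) hl₃.lt).mono fun m₄ hF₄ hw₄ => ?_
  exact ⟨a, b, _, hab, ha, hb, hl₃, h₃.frame hF₄ (by decide) (by decide),
    (hF₄.reg 2 (by decide)).trans h2₃, (hF₄.reg 3 (by decide)).trans h3₃,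
    by rw [hF₄.reg 4 (by decide), hF₃.reg 4 (by decide), h4],
    by rw [hF₄.reg 5 (by decide), hF₃.reg 5 (by decide), h5],
    fun v => by rw [hF₄.arr 2 (by decide), hF₃.arr 2 (by decide), hF₂.arr 2 (by decide), hd₁],
    fun v => by rw [hF₄.arr 3 (by decide)], hw₄⟩

/-- The whole program. -/
def solve (conn : Bool) : Prog :=
  .seq prepare (.seq (select conn true true) (.seq (select conn true false)
  (.seq (select conn false true) (.seq (select conn false false) (.seq (grow 2 3) (grow 3 2))))))

@[simp] theorem select_regs (conn fa fb : Bool) : (select conn fa fb).regs =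
    [6, 6, 6, 6, 6, 7, 7, 6, 11, 6, 1, 11, 6, 12, 6, 7, 12, 6, 6, 6] := rfl
@[simp] theorem select_arrs (conn fa fb : Bool) :
    (select conn fa fb).arrs = [5, 6, 6, 7, 7, 1] := rfl

/-- Division with remainder by `n` recovers the two vertices from a matrix index. -/
theorem hasGraph_inputMemory (G : SimpleGraph (Fin n)) : HasGraph G (inputMemory G) := by
  refine ⟨rfl, fun u v => ?_⟩
  simp only [inputMemory, true_and]
  congr 1
  refine propext ⟨?_, fun h => ⟨u, v, rfl, h⟩⟩
  rintro ⟨u', v', he, h⟩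
  have hn : 0 < n := u.pos
  have h1 := congrArg (· % n) he
  have h2 := congrArg (· / n) he
  simp only [Nat.mul_comm _ n, Nat.mul_add_mod, Nat.mul_add_div hn, Nat.mod_eq_of_lt v.2,
    Nat.mod_eq_of_lt v'.2, Nat.div_eq_of_lt v.2, Nat.div_eq_of_lt v'.2, add_zero] at h1 h2
  rwa [Fin.ext h2, Fin.ext h1]

theorem runs_solve (hn : 3 ≤ n) (hh : hIndex G ≤ 2) :
    Runs (n ^ 5) (loopBound n) (solve conn) (inputMemory G) fun m' => Best G conn m' ∧
      (∀ S, Target G conn S → S.card ≤ m'.reg 1) ∧ (conn = false → m'.reg 1 ≠ 0) := by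
  refine Runs.seq (runs_prepare hn (hasGraph_inputMemory G)) fun m₀ hF₀ hm₀ => ?_
  obtain ⟨a, b, lab, hab, hmaxa, hmaxb, hlab, p₀⟩ := hm₀
  have hdeg := degIn_le_two_of_hIndex G hab hmaxa hmaxb hh
  have b₀ : Best G conn m₀ := Or.inl (by rw [hF₀.reg 1 (by decide)]; rfl)
  refine Runs.seq (runs_select hn hab hlab p₀ b₀) fun m₁ hF₁ ⟨b₁, _, c₁⟩ => ?_
  have p₁ := p₀.frame hF₁ (by simp) (by simp)
  refine Runs.seq (runs_select hn hab hlab p₁ b₁) fun m₂ hF₂ ⟨b₂, r₂, c₂⟩ => ?_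
  have p₂ := p₁.frame hF₂ (by simp) (by simp)
  refine Runs.seq (runs_select hn hab hlab p₂ b₂) fun m₃ hF₃ ⟨b₃, r₃, c₃⟩ => ?_
  have p₃ := p₂.frame hF₃ (by simp) (by simp)
  refine Runs.seq (runs_select hn hab hlab p₃ b₃) fun m₄ hF₄ ⟨b₄, r₄, c₄⟩ => ?_
  have p₄ := p₃.frame hF₄ (by simp) (by simp)
  refine Runs.seq (runs_grow hn (Or.inl rfl) (Or.inr rfl) p₄.graph p₄.top₁ p₄.top₂ hab p₄.half hdeg
    b₄) fun m₅ hF₅ ⟨b₅, r₅, c₅⟩ => ?_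
  have p₅ := p₄.frame hF₅ (by simp) (by simp)
  refine (runs_grow hn (Or.inr rfl) (Or.inl rfl) p₅.graph p₅.top₂ p₅.top₁ hab.symm p₅.half
    (fun v h1 h2 => hdeg v h2 h1) b₅).mono fun m₆ _ ⟨b₆, r₆, c₆⟩ => ⟨b₆, ?_⟩
  have hV : Fintype.card (Fin n) = n := Fintype.card_fin n
  refine card_le_of_nbrClosed hdeg (by rwa [hV]) (fun S hcl hT => ?_) ?_
  -- Each closed target is covered by the run matching its membership of `a` and `b`, and later
  -- stages never lower register `1`.
  · by_cases ha : a ∈ S <;> by_cases hb : b ∈ S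
    · have := c₁ S hcl hT (by simp [ha]) (by simp [hb]); omega
    · have := c₂ S hcl hT (by simp [ha]) (by simp [hb]); omega
    · have := c₃ S hcl hT (by simp [ha]) (by simp [hb]); omega
    · have := c₄ S hcl hT (by simp [ha]) (by simp [hb]); omega
  · rw [hV]
    rcases c₅ with h | ⟨S, haS, hS, hSc⟩
    · left; omega
    rcases c₆ with h | ⟨T, hbT, hT, hTc⟩
    · left; omega
    -- Both growths got stuck below ⌈n/2⌉, so the graph is disconnected.
    · exact Or.inr (exists_isolated_of_small haS hbT hS hT (by rwa [hV]) (by rwa [hV]))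

/-- The four tables dominate with order n · n^4 each. Every lower power of `n` is absorbed into n^5,
and 10000 is a generous constant. -/
theorem time_solve_le (conn : Bool) {n : ℕ} (hn : 3 ≤ n) :
    (solve conn).time (loopBound n) ≤ 10000 * n ^ 5 := by
  have h0 : 1 ≤ n ^ 5 := Nat.one_le_pow _ _ (by omega)
  have h1 : n ≤ n ^ 5 := Nat.le_self_pow (by omega) n
  have h2 : n ^ 2 ≤ n ^ 5 := Nat.pow_le_pow_right (by omega) (by omega)
  have h3 : n ^ 3 ≤ n ^ 5 := Nat.pow_le_pow_right (by omega) (by omega)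
  have h4 : n ^ 4 ≤ n ^ 5 := Nat.pow_le_pow_right (by omega) (by omega)
  cases conn <;>
  · simp only [solve, prepare, degrees, chooseTop, labels, relabel, weights, select, items, itemExp,
      table, search, goodExp, sizeExp, backtrack, writeSelection, grow, addRound, addNbrs, other,
      time_forLoop, Prog.time, Exp.cost_zero, Exp.cost_one, Exp.cost_two, Exp.cost_const,
      Exp.cost_reg, Exp.cost_arr, Exp.cost_add, Exp.cost_sub, Exp.cost_mul, Exp.cost_div,
      Exp.cost_mod, Exp.cost_ltb, Exp.cost_eqb, loopBound, Bool.or_true, Bool.or_false,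
      Bool.and_true, Bool.and_false, if_true, if_false, Bool.false_eq_true,
      OfNat.zero_ne_ofNat]
    ring_nf
    omega

theorem solvable (conn : Bool) {Q : GraphProblem}
    (hQ : ∀ (n : ℕ) (G : SimpleGraph (Fin n)) (S : Finset (Fin n)),
      IsMaximumFor (Target G conn) S → Q n G (some S))
    (hnone : ∀ (n : ℕ) (G : SimpleGraph (Fin n)), conn = true → (∀ S, ¬ Target G conn S) →
      Q n G none) :
    SolvableInTime Q (fun n G => 3 ≤ n ∧ hIndex G ≤ 2) fun n => n ^ 5 := by
  refine ⟨solve conn, 10000, 5, fun n G ⟨hn, hh⟩ => ?_⟩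
  obtain ⟨t, m, he, ht, hbest, hmax, hne⟩ := runs_solve (conn := conn) hn hh
  refine ⟨t, m, he, ht.trans (time_solve_le conn hn), ?_⟩
  unfold output
  by_cases h1 : m.reg 1 = 0
  · rw [if_pos h1]
    -- A zero record forces the connected version, and since a target has at least two vertices,
    -- none exists.
    refine hnone n G (by_contra fun hc => hne (by simpa using hc) h1) fun S hS => ?_
    have := hmax S hS
    have := hS.1.1
    omega
  · obtain ⟨S, hT, hcard, hS⟩ := hbest.resolve_left h1
    rw [if_neg h1, show univ.filter (fun v : Fin n => m.arr 1 v ≠ 0) = S by ext v; simp [← hS v]]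
    exact hQ n G S ⟨hT, fun S' hS' => (hmax S' hS').trans hcard.ge⟩

end Solution

end WordRAM

theorem mainTheorem6 :
    SolvableInTime MaxPDS (fun n G => 3 ≤ n ∧ hIndex G ≤ 2) (fun n => n ^ 5) ∧
    SolvableInTime ConnectedMaxPDS (fun n G => 3 ≤ n ∧ hIndex G ≤ 2) (fun n => n ^ 5) := by
  refine ⟨WordRAM.solvable false (fun n G S hS => ⟨S, rfl, ?_⟩) (by simp),
    WordRAM.solvable true (fun n G S hS => Or.inl ⟨S, rfl, ?_⟩)
      (fun n G _ h => Or.inr ⟨rfl, fun S hS => h S ((target_true G S).2 hS)⟩)⟩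
  · exact ⟨(target_false G S).1 hS.1, fun S' h => hS.2 S' ((target_false G S').2 h)⟩
  · exact ⟨(target_true G S).1 hS.1, fun S' h => hS.2 S' ((target_true G S').2 h)⟩
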